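/- All graphs are finite and simple. A graph is $\{P_7,C_3\}$-free if it has no induced subgraph isomorphic to the path on $7$ vertices or to the triangle. An order 3 palette $L$ of a graph $G$ assigns to every vertex a non-empty set $L(v)\subseteq\{1,2,3\}$. For a set $X$ of subsets of $V(G)$, a coloring of $(G,L,X)$ is a map $c$ on $V(G)$ with $c(v)\in L(v)$ for all $v$, $c(u)\ne c(v)$ for adjacent $u,v$, and $c$ constant on every $S\in X$; $(G,L,X)$ is colorable if such a $c$ exists. A restriction of $(G,L,X)$ is a collection $\mathcal P$ of triples $(G',L',X')$, where $G'$ is an induced subgraph of $G$, $L'$ is a palette of $G'$ with $L'(v)\subseteq L(v)$ for all $v\in V(G')$ and $X'$ is a set of subsets of $V(G')$, such that if some member of $\mathcal P$ is colorable ("$\mathcal P$ is colorable") then $(G,L,X)$ is colorable, and any coloring of a member of $\mathcal P$ can be extended to a coloring of $(G,L,X)$ in time $O(|V(G)|)$. Let $L$ be an order 3 palette of a $\{P_7,C_3\}$-free graph $G$ whose vertex set is partitioned as $V(G)=\tilde A\cup\tilde B\cup\tilde C$, where - no vertex of $\tilde B$ is adjacent to a vertex of $\tilde C$; - every component of $G[\tilde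 C]$ has at most $2$ vertices; - every vertex of $\tilde C$ has a neighbor in $\tilde A$, and every vertex of $\tilde A$ has a neighbor in $\tilde C$; - $|L(a)|\le 2$ for every $a\in\tilde A$, and $|L(c)|=3$ for every $c\in\tilde C$; - $G$ has no dominated vertex, that is, there are no distinct non-adjacent $u,v$ with $N(u)\subseteq N(v)$. For distinct $i,j\in\{1,2,3\}$ let $\tilde A_{\{i,j\}}=\{a\in\tilde A: L(a)=\{i,j\}\}$, and for $c\in\tilde C$ let $N_{\{i,j\}}(c)=N(c)\cap\tilde A_{\{i,j\}}$ and $M_{\{i,j\}}(c)=\tilde A_{\{i,j\}}\setminus N(c)$. Assume also that - for all $c_1,c_2\in\tilde C$ and $\{i,j,k\}=\{1,2,3\}$, every vertex of $N_{\{i,j\}}(c_1)\cap M_{\{i,j\}}(c_2)$ is adjacent to every vertex of $M_{\{i,k\}}(c_1)\cap N_{\{i,k\}}(c_2)$; - for all distinct $i,j\in\{1,2,3\}$ there is a vertex of $\tilde B$ adjacent to every vertex of $\tilde A_{\{i,j\}}$. Let $Z$ be a set of subsets of $\tilde A$. Then there is a restriction $\mathcal P$ of $(G,L,Z)$ of size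 $O(|V(G)|^7)$ such that (a) $\tilde A\cup\tilde B\subseteq V(G')$ for every $(G',L',X')\in\mathcal P$; (b) for every $(G',L',X')\in\mathcal P$: $L'(v)=L(v)$ for every $v\in\tilde A\cup\tilde B$, $|L'(v)|\le 2$ for every $v\in V(G')\cap\tilde C$, and $|X'|=O(|Z|+|V(G)|)$; (c) if $(G,L,Z)$ is colorable, then $\mathcal P$ is colorable. Moreover, given $G$, $L$, $Z$ and the partition $\tilde A\cup\tilde B\cup\tilde C$, the collection $\mathcal P$ can be computed in time $O(|V(G)|^7)$. All implied constants are absolute. (Running times are numbers of unit-cost steps of a fixed random access machine program. The input $Z$ and the sets $X'$ of the output are stored as linked lists of vertex sets, which may share nodes. The extension of colorings starts from the memory in which $\mathcal P$ was computed.) -/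

import Mathlib

/-! ## A unit-cost machine

A random access machine with word variables and arrays of words (an array may have several
indices).  Every instruction touches a fixed number of words and costs one step.  The only
arithmetic is successor, predecessor and comparison, so a word grows by at most one per step:
on an input of words of `O(log N)` bits, a run of polynomial length only handles words of
`O(log N)` bits. -/

namespace RAM

structure State where
  /-- the word variables -/
  var : ℕ → ℕ
  /-- `arr a [i₁, …, iₖ]` is the entry of the array named `a` at the index `(i₁, …, iₖ)` -/
  arr : ℕ → List ℕ → ℕ

def State.setVar (s : State) (x k : ℕ) : State :=
  { s with var := Function.update s.var x k }

def State.setArr (s : State) (a : ℕ) (idx : List ℕ) (k : ℕ) : State :=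
  { s with arr := Function.update s.arr a (Function.update (s.arr a) idx k) }

/-- Comparisons between two variables. -/
inductive Test
  | eq (x y : ℕ)
  | lt (x y : ℕ)

def Test.Holds (s : State) : Test → Prop
  | .eq x y => s.var x = s.var y
  | .lt x y => s.var x < s.var y

/-- Programs.  All operands are names of variables, except the literal `k` in `const` and the
array names `a`; the indices of an array access are the values of the variables in `idx`. -/
inductive Cmd
  | skip
  | const (x k : ℕ)
  | copy (x y : ℕ)
  | succ (x y : ℕ)
  | pred (x y : ℕ)
  | load (x a : ℕ) (idx : List ℕ)
  | store (a : ℕ) (idx : List ℕ) (y : ℕ)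
  | seq (p q : Cmd)
  | branch (b : Test) (p q : Cmd)
  | loop (b : Test) (p : Cmd)

/-- `Exec p s s' t`: started in the state `s`, the program `p` halts in the state `s'` after
exactly `t` steps. -/
inductive Exec : Cmd → State → State → ℕ → Prop
  | skip (s : State) : Exec .skip s s 0
  | const (s : State) (x k : ℕ) : Exec (.const x k) s (s.setVar x k) 1
  | copy (s : State) (x y : ℕ) : Exec (.copy x y) s (s.setVar x (s.var y)) 1
  | succ (s : State) (x y : ℕ) : Exec (.succ x y) s (s.setVar x (s.var y + 1)) 1
  | pred (s : State) (x y : ℕ) : Exec (.pred x y) s (s.setVar x (s.var y - 1)) 1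
  | load (s : State) (x a : ℕ) (idx : List ℕ) :
      Exec (.load x a idx) s (s.setVar x (s.arr a (idx.map s.var))) 1
  | store (s : State) (a : ℕ) (idx : List ℕ) (y : ℕ) :
      Exec (.store a idx y) s (s.setArr a (idx.map s.var) (s.var y)) 1
  | seq {p q : Cmd} {s s₁ s₂ : State} {t₁ t₂ : ℕ} :
      Exec p s s₁ t₁ → Exec q s₁ s₂ t₂ → Exec (.seq p q) s s₂ (t₁ + t₂)
  | branchTrue {b : Test} {p q : Cmd} {s s' : State} {t : ℕ} :
      b.Holds s → Exec p s s' t → Exec (.branch b p q) s s' (t + 1)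
  | branchFalse {b : Test} {p q : Cmd} {s s' : State} {t : ℕ} :
      ¬ b.Holds s → Exec q s s' t → Exec (.branch b p q) s s' (t + 1)
  | loopTrue {b : Test} {p : Cmd} {s s₁ s₂ : State} {t₁ t₂ : ℕ} :
      b.Holds s → Exec p s s₁ t₁ → Exec (.loop b p) s₁ s₂ t₂ →
      Exec (.loop b p) s s₂ (t₁ + t₂ + 1)
  | loopFalse {b : Test} {p : Cmd} {s : State} :
      ¬ b.Holds s → Exec (.loop b p) s s 1

end RAM

/-! ## Palettes, monochromatic constraints and restrictions -/

namespace ListColoring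

variable {V : Type*}

/-- The vertex `u` is dominated: some other vertex, not adjacent to `u`, is adjacent to all
neighbours of `u`. -/
def IsDominated (G : SimpleGraph V) (u : V) : Prop :=
  ∃ v, v ≠ u ∧ ¬ G.Adj u v ∧ G.neighborSet u ⊆ G.neighborSet v

def CompleteTo (G : SimpleGraph V) (S T : Set V) : Prop :=
  ∀ s ∈ S, ∀ t ∈ T, G.Adj s t

def AnticompleteTo (G : SimpleGraph V) (S T : Set V) : Prop :=
  ∀ s ∈ S, ∀ t ∈ T, ¬ G.Adj s t

/-- The vertices of `A` whose list is exactly `X`. -/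
def listClass (L : V → Finset (Fin 3)) (A : Finset V) (X : Finset (Fin 3)) : Set V :=
  {a | a ∈ A ∧ L a = X}

/-- `N_{i,j}(c)`: the neighbours of `c` among the vertices of `A` with list `{i,j}`. -/
def nbrs (G : SimpleGraph V) (L : V → Finset (Fin 3)) (A : Finset V) (i j : Fin 3) (c : V) :
    Set V :=
  G.neighborSet c ∩ listClass L A {i, j}

/-- `M_{i,j}(c)`: the non-neighbours of `c` among the vertices of `A` with list `{i,j}`. -/
def nonNbrs (G : SimpleGraph V) (L : V → Finset (Fin 3)) (A : Finset V) (i j : Fin 3) (c : V) :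
    Set V :=
  listClass L A {i, j} \ G.neighborSet c

/-- A triple `(G[verts], pal, cons)` in an ambient graph `G`: an induced subgraph, a list of
colours for each of its vertices (the value of `pal` outside `verts` is irrelevant), and a set
of vertex sets that have to be monochromatic. The three colours are the elements of `Fin 3`. -/
structure Triple (V : Type*) where
  verts : Finset V
  pal : V → Finset (Fin 3)
  cons : Finset (Finset V)

/-- The triple `(G, L, Z)` on all vertices. -/
def Triple.full [Fintype V] (L : V → Finset (Fin 3)) (Z : Finset (Finset V)) : Triple V :=
  ⟨Finset.univ, L, Z⟩

/-- `c` (restricted to the vertices of `T`) is a colouring of the triple `T`. -/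
def Triple.IsColoring (G : SimpleGraph V) (T : Triple V) (c : V → Fin 3) : Prop :=
  (∀ u ∈ T.verts, ∀ v ∈ T.verts, G.Adj u v → c u ≠ c v) ∧
  (∀ v ∈ T.verts, c v ∈ T.pal v) ∧
  (∀ S ∈ T.cons, ∀ u ∈ S, ∀ v ∈ S, c u = c v)

def Triple.Colorable (G : SimpleGraph V) (T : Triple V) : Prop :=
  ∃ c, T.IsColoring G c

/-- `T` consists of an induced subgraph, a subpalette of the palette of `T₀` on it (all lists
non-empty), and a set of subsets of its vertex set. -/
def Triple.IsSub (T T₀ : Triple V) : Prop :=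
  T.verts ⊆ T₀.verts ∧
  (∀ v ∈ T.verts, (T.pal v).Nonempty ∧ T.pal v ⊆ T₀.pal v) ∧
  (∀ S ∈ T.cons, S ⊆ T.verts)

/-- A collection of triples is colorable if one of its members is. -/
def CollColorable (G : SimpleGraph V) (P : List (Triple V)) : Prop :=
  ∃ T ∈ P, T.Colorable G

/-! ## Inputs and outputs of the programs -/

/-- The truth value of a proposition as a word. -/
noncomputable def bit (p : Prop) : ℕ :=
  open Classical in if p then 1 else 0

/-- Membership of a word in a set of vertices `0, …, n - 1`. -/
def MemWord {n : ℕ} (S : Finset (Fin n)) (v : ℕ) : Prop :=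
  ∃ h : v < n, (⟨v, h⟩ : Fin n) ∈ S

/-- The input: variable `0` holds `n`, the arrays `0` to `4` hold the adjacency matrix, the lists
and the three parts.  The sets of `zs` are handed over as a linked list whose nodes are
`1, …, zs.length`: `arr 5 [t, v]` tells whether `v` belongs to the set at the node `t`,
`arr 6 [t]` is the next node (`0` ends the list), and variable `1` holds the first node, which is
`zs.length`. Everything else is `0`. -/
noncomputable def inputState {n : ℕ} (G : SimpleGraph (Fin n)) (L : Fin n → Finset (Fin 3))
    (A B C : Finset (Fin n)) (zs : List (Finset (Fin n))) : RAM.State where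
  var x := match x with
    | 0 => n
    | 1 => zs.length
    | _ => 0
  arr a idx := match a, idx with
    | 0, [u, v] => bit (∃ (hu : u < n) (hv : v < n), G.Adj ⟨u, hu⟩ ⟨v, hv⟩)
    | 1, [v, i] => bit (∃ (hv : v < n) (hi : i < 3), (⟨i, hi⟩ : Fin 3) ∈ L ⟨v, hv⟩)
    | 2, [v] => bit (MemWord A v)
    | 3, [v] => bit (MemWord B v)
    | 4, [v] => bit (MemWord C v)
    | 5, [t, v] => bit (∃ h : t - 1 < zs.length, 1 ≤ t ∧ MemWord (zs.get ⟨t - 1, h⟩) v)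
    | 6, [t] => if t ≤ zs.length then t - 1 else 0
    | _, _ => 0

/-- In the state `s`, the linked list (in the arrays `5` and `6`, as in the input) with first
node `t` spells out the list of vertex sets `l`. -/
def IsLinkedList {n : ℕ} (s : RAM.State) : ℕ → List (Finset (Fin n)) → Prop
  | t, [] => t = 0
  | t, S :: l => t ≠ 0 ∧ (∀ v : Fin n, s.arr 5 [t, v] = bit (v ∈ S)) ∧
      IsLinkedList s (s.arr 6 [t]) l

/-- The state `s` holds the collection `P`: variable `2` is the number of members, and for the
`p`-th member, `arr 7 [p, v]` tells whether `v` is a vertex of it, `arr 8 [p, v, i]` whether the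
colour `i` is in the list of its vertex `v`, and `arr 9 [p]` is the first node of a linked list
of its constraint sets. Different linked lists may share nodes. -/
def IsOutput {n : ℕ} (s : RAM.State) (P : List (Triple (Fin n))) : Prop :=
  s.var 2 = P.length ∧
  ∀ (p : ℕ) (hp : p < P.length),
    (∀ v : Fin n, s.arr 7 [p, v] = bit (v ∈ P[p].verts)) ∧
    (∀ v ∈ P[p].verts, ∀ i : Fin 3, s.arr 8 [p, v, i] = bit (i ∈ P[p].pal v)) ∧
    ∃ l : List (Finset (Fin n)), l.toFinset = P[p].cons ∧ IsLinkedList s (s.arr 9 [p]) l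

/-- The state `s` after being handed a colouring `c` of the `p`-th member, with vertex set `U`:
variable `3` holds `p`, and `arr 10 [v]` holds `c v + 1` if `v ∈ U` and `0` otherwise. -/
noncomputable def withColoring {n : ℕ} (s : RAM.State) (p : ℕ) (U : Finset (Fin n))
    (c : Fin n → Fin 3) : RAM.State where
  var x := if x = 3 then p else s.var x
  arr a idx := if a = 10 then
      match idx with
      | [v] => open Classical in if h : v < n then
          (if (⟨v, h⟩ : Fin n) ∈ U then (c ⟨v, h⟩ : ℕ) + 1 else 0) else 0
      | _ => 0
    else s.arr a idx

/-- The state `s` holds the colouring `c` of all vertices in the array `10`. -/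
def HoldsColoring {n : ℕ} (s : RAM.State) (c : Fin n → Fin 3) : Prop :=
  ∀ v : Fin n, s.arr 10 [v] = (c v : ℕ) + 1

/-- From the memory `s` that holds the collection `P`, the program `ext` extends every colouring
of every member of `P` to a colouring of `T₀`, each in at most `time` steps. -/
def ExtendsWithin {n : ℕ} (ext : RAM.Cmd) (s : RAM.State) (G : SimpleGraph (Fin n))
    (P : List (Triple (Fin n))) (T₀ : Triple (Fin n)) (time : ℕ) : Prop :=
  ∀ (p : ℕ) (hp : p < P.length) (c : Fin n → Fin 3), P[p].IsColoring G c →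
    ∃ (s' : RAM.State) (t : ℕ) (c' : Fin n → Fin 3),
      RAM.Exec ext (withColoring s p P[p].verts c) s' t ∧ t ≤ time ∧
      HoldsColoring s' c' ∧ T₀.IsColoring G c' ∧ ∀ v ∈ P[p].verts, c' v = c v

end ListColoring

/-!
Only the lists of the vertices of `C` are shrunk: every member of the collection has all vertices,
the constraints `Z`, and the lists `L` outside `C`.  So a colouring of a member already is a
colouring of `(G, L, Z)`, and all that has to be shown is that for every colouring `φ` there is a
member which `φ`, up to recolouring some vertices of `C`, respects.  A member is given by five
vertices `a 0`, `a 1`, `a 2`, `p`, `q` and a bounded amount of further data (`Pattern`).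

* Fix a colour `i`, and let `P c` and `Q c` be the sets of neighbours coloured `i` of `c ∈ C` with
  list `{i, j}` and `{i, k}`.  By the assumption on complete pairs, `P c ⊆ P d` or `Q d ⊆ Q c` for
  all `c`, `d`, as otherwise two adjacent vertices would have colour `i`.  Families of this kind have
  a common witness (`exists_common_mem_or`): for one of the two lists, say `{i, k}`, there is a vertex
  `a i` of colour `i` adjacent to every `c` that has a neighbour with list `{i, k}` and colour `i`.
  Hence the neighbours of `a i` cannot be coloured `i`, and for the other `c ∈ C` all neighbours with
  list `{i, k}` have colour `k`, so that a vertex having one cannot be coloured `k`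
  (`exists_guess_of_color`).
* Doing this for the three colours covers at least two of the three two-element lists.  A vertex of
  `C` that still may have any colour therefore has all its neighbours in `A` in one class, with
  list `{x, y}`.  If it has no neighbour in `C`, it may be recoloured with the third colour `z`.
* Otherwise it lies in an edge of `G[C]`.  The class has a common neighbour in `B`, so if two
  edges of `G[C]` had private neighbours in the class, there would be an induced path on seven
  vertices: the sets of neighbours of these edges form a chain (`nbrs_of_edges_chain`).  Let `p` be
  a vertex of the smallest of these sets, coloured `x`, say, and `q` a vertex coloured `y` of the
  smallest one in which the colour `y` occurs.  Then each of the edges sees `p`, and it sees `q` or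
  else only the colour `x`, which rules out a colour for each end that still had all three
  (`exists_guess_of_chain`, `exists_reduced_coloring`).

The lists of a member are described by a formula with quantifiers over one vertex only
(`reducedFm`), which a program decides for one vertex in linear time (`Fm.runs`).  Writing one member
thus takes quadratic time, and there are `O(n ^ 5)` of them.
-/

namespace ListColoring

/-! ### A common witness for two interlocked families of sets -/

/-- A pair `(P c, Q c)` with `Q c` nonempty of least total size has a member of `P c` or of `Q c` in
common with all other such pairs. -/
theorem exists_common_mem {α β : Type*} [DecidableEq β] (C : Finset α) (P Q : α → Finset β)
    (h : ∀ c ∈ C, ∀ d ∈ C, P c ⊆ P d ∨ Q d ⊆ Q c)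
    (hPQ : ∀ c ∈ C, (Q c).Nonempty → (P c).Nonempty) (hQ : ∃ c ∈ C, (Q c).Nonempty) :
    ∃ w, (∃ c ∈ C, w ∈ P c ∪ Q c) ∧ ∀ c ∈ C, (Q c).Nonempty → w ∈ P c ∪ Q c := by
  classical
  have hne : (C.filter fun c => (Q c).Nonempty).Nonempty := by
    obtain ⟨c, hc, hcQ⟩ := hQ
    exact ⟨c, Finset.mem_filter.2 ⟨hc, hcQ⟩⟩
  obtain ⟨c₀, hc₀, hmin⟩ :=
    Finset.exists_min_image _ (fun c => (P c).card + (Q c).card) hne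
  obtain ⟨hc₀C, hc₀Q⟩ := Finset.mem_filter.1 hc₀
  -- Two sets at `c` and `c₀` that are not nested upwards make the pair at `c` strictly smaller.
  have hor : ∀ c ∈ C, (Q c).Nonempty → P c₀ ⊆ P c ∨ Q c₀ ⊆ Q c := by
    intro c hc hcQ
    by_contra! hcon
    have h₁ : Q c ⊆ Q c₀ := (h c₀ hc₀C c hc).resolve_left hcon.1
    have h₂ : P c ⊆ P c₀ := (h c hc c₀ hc₀C).resolve_right hcon.2
    have h₃ := Finset.card_lt_card (Finset.ssubset_iff_subset_ne.2
      ⟨h₁, fun e => hcon.2 e.symm.subset⟩)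
    have h₄ := Finset.card_le_card h₂
    have := hmin c (Finset.mem_filter.2 ⟨hc, hcQ⟩)
    omega
  by_cases hP : ∀ c ∈ C, (Q c).Nonempty → P c₀ ⊆ P c
  · obtain ⟨w, hw⟩ := hPQ c₀ hc₀C hc₀Q
    exact ⟨w, ⟨c₀, hc₀C, Finset.mem_union_left _ hw⟩,
      fun c hc hcQ => Finset.mem_union_left _ (hP c hc hcQ hw)⟩
  · push Not at hP
    obtain ⟨c₁, hc₁, hc₁Q, hc₁P⟩ := hP
    obtain ⟨w, hw⟩ := hc₀Q
    refine ⟨w, ⟨c₀, hc₀C, Finset.mem_union_right _ hw⟩,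
      fun c hc hcQ => Finset.mem_union_right _ ?_⟩
    by_contra hwc
    have hn : ¬ Q c₀ ⊆ Q c := fun hs => hwc (hs hw)
    have h₁ : Q c₀ ⊆ Q c₁ := (hor c₁ hc₁ hc₁Q).resolve_left hc₁P
    have h₂ : P c₀ ⊆ P c := (hor c hc hcQ).resolve_right hn
    have h₃ : P c ⊆ P c₀ := (h c hc c₀ hc₀C).resolve_right hn
    rcases h c hc c₁ hc₁ with h₄ | h₄
    · exact hc₁P (h₂.trans h₄)
    · exact hn (h₁.trans h₄)

theorem exists_common_mem_or {α β : Type*} [DecidableEq β] (C : Finset α) (P Q : α → Finset β)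
    (h : ∀ c ∈ C, ∀ d ∈ C, P c ⊆ P d ∨ Q d ⊆ Q c) :
    (∀ c ∈ C, Q c = ∅) ∨
    (∃ w, (∃ c ∈ C, w ∈ P c ∪ Q c) ∧ ∀ c ∈ C, (Q c).Nonempty → w ∈ P c ∪ Q c) ∨
    (∃ w, (∃ c ∈ C, w ∈ P c ∪ Q c) ∧ ∀ c ∈ C, (P c).Nonempty → w ∈ P c ∪ Q c) := by
  by_cases hQ : ∃ c ∈ C, (Q c).Nonempty
  · by_cases hPQ : ∀ c ∈ C, (Q c).Nonempty → (P c).Nonempty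
    · exact .inr (.inl (exists_common_mem C P Q h hPQ hQ))
    · push Not at hPQ
      obtain ⟨d, hd, ⟨w, hw⟩, hdP⟩ := hPQ
      refine .inr (.inr ⟨w, ⟨d, hd, Finset.mem_union_right _ hw⟩, fun c hc hcP => ?_⟩)
      refine Finset.mem_union_right _ ((h c hc d hd).resolve_left (fun hs => ?_) hw)
      exact hcP.ne_empty (Finset.subset_empty.1 (hdP ▸ hs))
  · refine .inl fun c hc => ?_
    by_contra hne
    exact hQ ⟨c, hc, Finset.nonempty_iff_ne_empty.2 hne⟩

/-! ### Guessing one vertex per colour -/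

variable {V : Type*}

/-- For every colour `i` there are a list `{i, k}` and a vertex `a` such that in the colouring `φ` no
neighbour of `a` in `C` has colour `i`, and the non-neighbours of `a` in `C` see only the colour `k`
in the class with list `{i, k}`.  The vertex `b` serves as `a` when no vertex needs to be chosen. -/
theorem exists_guess_of_color (G : SimpleGraph V) (L : V → Finset (Fin 3)) (A C : Finset V)
    (φ : V → Fin 3) (hφ : ∀ u v, G.Adj u v → φ u ≠ φ v) (hφL : ∀ v, φ v ∈ L v)
    (hcomp : ∀ c₁ ∈ C, ∀ c₂ ∈ C, ∀ i j k : Fin 3, i ≠ j → i ≠ k → j ≠ k →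
      CompleteTo G (nbrs G L A i j c₁ ∩ nonNbrs G L A i j c₂)
        (nonNbrs G L A i k c₁ ∩ nbrs G L A i k c₂))
    (b : V) (hb : ∀ c ∈ C, ¬ G.Adj c b) (i : Fin 3) :
    ∃ k, k ≠ i ∧ ∃ a, (∀ c ∈ C, G.Adj c a → φ c ≠ i) ∧
      ∀ c ∈ C, ¬ G.Adj c a → ∀ w ∈ A, G.Adj c w → L w = {i, k} → φ w = k := by
  classical
  let P : Fin 3 → V → Finset V := fun j c => A.filter fun w => G.Adj c w ∧ L w = {i, j} ∧ φ w = i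
  have memP : ∀ j c w, w ∈ P j c ↔ w ∈ A ∧ G.Adj c w ∧ L w = {i, j} ∧ φ w = i := fun j c w => by
    simp [P]
  obtain ⟨j, k, hij, hik, hjk⟩ : ∃ j k : Fin 3, i ≠ j ∧ i ≠ k ∧ j ≠ k := by
    clear * -
    revert i
    decide
  have h : ∀ c ∈ C, ∀ d ∈ C, P j c ⊆ P j d ∨ P k d ⊆ P k c := by
    intro c hc d hd
    by_contra! hcon
    obtain ⟨⟨u, hu, hu'⟩, ⟨w, hw, hw'⟩⟩ := And.intro (Finset.not_subset.1 hcon.1)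
      (Finset.not_subset.1 hcon.2)
    rw [memP] at hu hu' hw hw'
    have hud : ¬ G.Adj d u := fun hh => hu' ⟨hu.1, hh, hu.2.2⟩
    have hwc : ¬ G.Adj c w := fun hh => hw' ⟨hw.1, hh, hw.2.2⟩
    have := hcomp c hc d hd i j k hij hik hjk u
      ⟨⟨hu.2.1, hu.1, hu.2.2.1⟩, ⟨hu.1, hu.2.2.1⟩, hud⟩ w
      ⟨⟨⟨hw.1, hw.2.2.1⟩, hwc⟩, hw.2.1, hw.1, hw.2.2.1⟩
    exact hφ u w this (hu.2.2.2.trans hw.2.2.2.symm)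
  have key : ∀ l a, (∀ c ∈ C, ¬ G.Adj c a → P l c = ∅) →
      ∀ c ∈ C, ¬ G.Adj c a → ∀ w ∈ A, G.Adj c w → L w = {i, l} → φ w = l := by
    intro l a ha c hc hca w hw hcw hL
    have h₁ := hφL w
    rw [hL] at h₁
    rcases Finset.mem_insert.1 h₁ with h₂ | h₂
    · have : w ∈ P l c := (memP _ _ _).2 ⟨hw, hcw, hL, h₂⟩
      rw [ha c hc hca] at this
      simp at this
    · exact Finset.mem_singleton.1 h₂
  have color : ∀ w, (∃ c ∈ C, w ∈ P j c ∪ P k c) → ∀ c ∈ C, G.Adj c w → φ c ≠ i := by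
    rintro w ⟨d, -, hw⟩ c - hcw
    have : φ w = i := by
      rcases Finset.mem_union.1 hw with hw | hw <;> exact ((memP _ _ _).1 hw).2.2.2
    exact this ▸ hφ c w hcw
  have adj : ∀ w c, w ∈ P j c ∪ P k c → G.Adj c w := by
    intro w c hw
    rcases Finset.mem_union.1 hw with hw | hw <;> exact ((memP _ _ _).1 hw).2.1
  rcases exists_common_mem_or C (P j) (P k) h with h | ⟨w, hw, h⟩ | ⟨w, hw, h⟩
  · exact ⟨k, hik.symm, b, fun c hc hcb => absurd hcb (hb c hc), key k b fun c hc _ => h c hc⟩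
  · refine ⟨k, hik.symm, w, color w hw, key k w fun c hc hcw => ?_⟩
    by_contra hne
    exact hcw (adj w c (h c hc (Finset.nonempty_iff_ne_empty.2 hne)))
  · refine ⟨j, hij.symm, w, color w hw, key j w fun c hc hcw => ?_⟩
    by_contra hne
    exact hcw (adj w c (h c hc (Finset.nonempty_iff_ne_empty.2 hne)))

/-! ### Components with two vertices -/

theorem eq_of_adj_of_adj (G : SimpleGraph V) (C : Set V)
    (hC : ∀ D : (G.induce C).ConnectedComponent, D.supp.ncard ≤ 2) [Finite V]
    {u v w : V} (hu : u ∈ C) (hv : v ∈ C) (hw : w ∈ C) (huv : G.Adj u v) (hvw : G.Adj v w) :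
    u = w := by
  by_contra hne
  let D := (G.induce C).connectedComponentMk ⟨v, hv⟩
  have h₁ : (G.induce C).Adj ⟨u, hu⟩ ⟨v, hv⟩ := huv
  have h₂ : (G.induce C).Adj ⟨w, hw⟩ ⟨v, hv⟩ := hvw.symm
  have hsub : ({⟨u, hu⟩, ⟨v, hv⟩, ⟨w, hw⟩} : Set C) ⊆ D.supp := by
    rintro x (rfl | rfl | rfl)
    · exact SimpleGraph.ConnectedComponent.sound h₁.reachable
    · rfl
    · exact SimpleGraph.ConnectedComponent.sound h₂.reachable
  have h₃ := Set.ncard_le_ncard hsub (Set.toFinite _)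
  rw [Set.ncard_eq_three.2 ⟨_, _, _, by simpa using huv.ne, by simpa using hne,
    by simpa using hvw.ne, rfl⟩] at h₃
  have := hC D
  omega

theorem not_adj_of_adj_adj (G : SimpleGraph V) (h : ¬ (SimpleGraph.cycleGraph 3).IsIndContained G)
    {u v w : V} (huv : G.Adj u v) (hvw : G.Adj v w) : ¬ G.Adj u w := by
  intro huw
  have hadj : ∀ i j : Fin 3, G.Adj (![u, v, w] i) (![u, v, w] j) ↔
      (SimpleGraph.cycleGraph 3).Adj i j := by
    intro i j
    rw [SimpleGraph.cycleGraph_three_eq_top]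
    fin_cases i <;> fin_cases j <;> simp [huv, hvw, huw, huv.symm, hvw.symm, huw.symm]
  refine h ⟨⟨⟨![u, v, w], ?_⟩, fun {i j} => hadj i j⟩⟩
  intro i j hij
  by_contra hne
  have h₁ : (SimpleGraph.cycleGraph 3).Adj i j := by
    rw [SimpleGraph.cycleGraph_three_eq_top]
    exact hne
  rw [← hadj, hij] at h₁
  exact G.irrefl h₁

/-- Two edges of `C` with private neighbours `u` and `w` having a common neighbour `b`: the
path `e' e u b w f f'` would be an induced `P₇`. -/
theorem no_private_neighbours (G : SimpleGraph V)
    (h7 : ¬ (SimpleGraph.pathGraph 7).IsIndContained G)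
    (h3 : ¬ (SimpleGraph.cycleGraph 3).IsIndContained G) {e e' f f' u w b : V}
    (hee : G.Adj e e') (hff : G.Adj f f') (hue : G.Adj e u) (hwf : G.Adj f w)
    (hbu : G.Adj b u) (hbw : G.Adj b w)
    (hbe : ¬ G.Adj b e) (hbe' : ¬ G.Adj b e') (hbf : ¬ G.Adj b f) (hbf' : ¬ G.Adj b f')
    (huf : ¬ G.Adj f u) (huf' : ¬ G.Adj f' u) (hwe : ¬ G.Adj e w) (hwe' : ¬ G.Adj e' w)
    (hef : ¬ G.Adj e f) (hef' : ¬ G.Adj e f') (hef₁ : ¬ G.Adj e' f) (hef₂ : ¬ G.Adj e' f') :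
    False := by
  have t₁ : ¬ G.Adj e' u := not_adj_of_adj_adj G h3 hee.symm hue
  have t₂ : ¬ G.Adj f' w := not_adj_of_adj_adj G h3 hff.symm hwf
  have t₃ : ¬ G.Adj u w := not_adj_of_adj_adj G h3 hbu.symm hbw
  have hadj : ∀ i j : Fin 7, G.Adj (![e', e, u, b, w, f, f'] i) (![e', e, u, b, w, f, f'] j) ↔
      (SimpleGraph.pathGraph 7).Adj i j := by
    intro i j
    rw [SimpleGraph.pathGraph_adj]
    fin_cases i <;> fin_cases j <;> simp_all [G.adj_comm]
  refine h7 ⟨⟨⟨![e', e, u, b, w, f, f'], ?_⟩, fun {i j} => hadj i j⟩⟩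
  -- Distinct vertices of the path have distinct neighbourhoods in it.
  intro i j hij
  have hnb : ∀ k, (SimpleGraph.pathGraph 7).Adj i k ↔ (SimpleGraph.pathGraph 7).Adj j k := by
    intro k
    rw [← hadj, ← hadj, hij]
  simp only [SimpleGraph.pathGraph_adj] at hnb
  have hdec : ∀ i j : Fin 7, (∀ k : Fin 7, (i.val + 1 = k.val ∨ k.val + 1 = i.val) ↔
      (j.val + 1 = k.val ∨ k.val + 1 = j.val)) → i = j := by decide
  exact hdec i j hnb

/-! ### The reduced lists -/

/-- The part of a guess that does not depend on the graph: a map `σ` on the colours and three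
colours `x`, `y`, `z`. -/
abbrev Pattern := (Fin 3 → Fin 3) × Fin 3 × Fin 3 × Fin 3

/-- The colour `i` is ruled out for `c` when the vertex `a j` has colour `j` (or no neighbour
in `C`) for every `j`, the vertices `p` and `q` have the colours `x` and `y` (or no neighbour in
`C`), and for every `t` all neighbours with list `{t, σ t}` of a vertex not adjacent to `a t`
have colour `σ t`. -/
def Excluded (G : SimpleGraph V) (L : V → Finset (Fin 3)) (A : Finset V) (π : Pattern)
    (a : Fin 3 → V) (p q c : V) (i : Fin 3) : Prop :=
  (∃ w ∈ A, G.Adj c w ∧ L w = {i}) ∨ G.Adj c (a i) ∨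
  (∃ t, π.1 t = i ∧ ¬ G.Adj c (a t) ∧ ∃ w ∈ A, G.Adj c w ∧ L w = {t, i}) ∨
  (i = π.2.1 ∧ G.Adj c p) ∨ (i = π.2.2.1 ∧ G.Adj c q)

/-- The colour `i` belongs to the list of `v` after the guess.  The list of a vertex of `C` always
ends up with one or two colours: if no colour or (without a neighbour in `C`) every colour
is left, it becomes `{z}`. -/
def Reduced (G : SimpleGraph V) (L : V → Finset (Fin 3)) (A C : Finset V) (π : Pattern)
    (a : Fin 3 → V) (p q v : V) (i : Fin 3) : Prop :=
  (v ∉ C ∧ i ∈ L v) ∨ v ∈ C ∧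
    (((∀ j, Excluded G L A π a p q v j) ∧ i = π.2.2.2) ∨
     ((∀ j, ¬ Excluded G L A π a p q v j) ∧
       (((¬ ∃ w ∈ C, G.Adj v w) ∧ i = π.2.2.2) ∨
        ((∃ w ∈ C, G.Adj v w ∧ G.Adj w q) ∧ i ≠ π.2.2.2) ∨
        ((∃ w ∈ C, G.Adj v w) ∧ (¬ ∃ w ∈ C, G.Adj v w ∧ G.Adj w q) ∧ i ≠ π.2.1))) ∨
     ((∃ j, Excluded G L A π a p q v j) ∧ ¬ Excluded G L A π a p q v i))

theorem Reduced.nonempty {G : SimpleGraph V} {L : V → Finset (Fin 3)} {A C : Finset V}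
    {π : Pattern} {a : Fin 3 → V} {p q v : V} (hL : (L v).Nonempty) :
    ∃ i, Reduced G L A C π a p q v i := by
  have hne : ∀ k : Fin 3, ∃ i, i ≠ k := by decide
  unfold Reduced
  by_cases hv : v ∈ C
  · by_cases h₁ : ∀ j, Excluded G L A π a p q v j
    · exact ⟨_, .inr ⟨hv, .inl ⟨h₁, rfl⟩⟩⟩
    · by_cases h₂ : ∃ j, Excluded G L A π a p q v j
      · push Not at h₁
        exact h₁.imp fun i hi => .inr ⟨hv, .inr (.inr ⟨h₂, hi⟩)⟩
      · have h₂' := not_exists.1 h₂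
        by_cases h₃ : ∃ w ∈ C, G.Adj v w
        · by_cases h₄ : ∃ w ∈ C, G.Adj v w ∧ G.Adj w q
          · exact (hne π.2.2.2).imp fun i hi =>
              .inr ⟨hv, .inr (.inl ⟨h₂', .inr (.inl ⟨h₄, hi⟩)⟩)⟩
          · exact (hne π.2.1).imp fun i hi =>
              .inr ⟨hv, .inr (.inl ⟨h₂', .inr (.inr ⟨h₃, h₄, hi⟩)⟩)⟩
        · exact ⟨_, .inr ⟨hv, .inr (.inl ⟨h₂', .inl ⟨h₃, rfl⟩⟩)⟩⟩
  · exact hL.imp fun i hi => .inl ⟨hv, hi⟩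

/-- After the guess, no vertex of `C` has all three colours in its list. -/
theorem Reduced.exists_not {G : SimpleGraph V} {L : V → Finset (Fin 3)} {A C : Finset V}
    {π : Pattern} {a : Fin 3 → V} {p q v : V} (hv : v ∈ C) :
    ∃ i, ¬ Reduced G L A C π a p q v i := by
  have hne : ∀ k : Fin 3, ∃ i, i ≠ k := by decide
  by_cases h₁ : ∃ j, Excluded G L A π a p q v j
  · by_cases h₂ : ∀ j, Excluded G L A π a p q v j
    · obtain ⟨i, hi⟩ := hne π.2.2.2
      refine ⟨i, ?_⟩
      simp only [Reduced]
      tauto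
    · obtain ⟨j, hj⟩ := h₁
      refine ⟨j, ?_⟩
      have h₃ : ¬ ∀ j, ¬ Excluded G L A π a p q v j := fun h => h j hj
      simp only [Reduced]
      tauto
  · have h₂ : ¬ ∀ j, Excluded G L A π a p q v j := fun h => h₁ ⟨0, h 0⟩
    by_cases h₃ : ∃ w ∈ C, G.Adj v w
    · by_cases h₄ : ∃ w ∈ C, G.Adj v w ∧ G.Adj w q
      · refine ⟨π.2.2.2, ?_⟩
        simp [Reduced, hv, h₁, h₂, h₃, h₄]
      · refine ⟨π.2.1, ?_⟩
        simp [Reduced, hv, h₁, h₂, h₃, h₄]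
    · obtain ⟨i, hi⟩ := hne π.2.2.2
      have h₄ : ¬ ∃ w ∈ C, G.Adj v w ∧ G.Adj w q := fun ⟨w, hw, h, _⟩ => h₃ ⟨w, hw, h⟩
      refine ⟨i, ?_⟩
      simp [Reduced, hv, h₁, h₂, h₃, h₄, hi]

theorem reduced_iff_of_notMem {G : SimpleGraph V} {L : V → Finset (Fin 3)} {A C : Finset V}
    {π : Pattern} {a : Fin 3 → V} {p q v : V} (hv : v ∉ C) (i : Fin 3) :
    Reduced G L A C π a p q v i ↔ i ∈ L v := by
  simp [Reduced, hv]

/-! ### The guess belonging to a colouring -/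

theorem exists_subset_forall {α β : Type*} (E : Finset α) (U : α → Finset β) (hE : E.Nonempty)
    (hU : ∀ c ∈ E, ∀ d ∈ E, U c ⊆ U d ∨ U d ⊆ U c) : ∃ c ∈ E, ∀ d ∈ E, U c ⊆ U d := by
  obtain ⟨c, hc, hmin⟩ := Finset.exists_min_image E (fun c => (U c).card) hE
  refine ⟨c, hc, fun d hd => ?_⟩
  rcases hU c hc d hd with h | h
  · exact h
  · exact (Finset.eq_of_subset_of_card_le h (hmin d hd)).symm.subset

/-- Two vertices of a family of nested sets suffice to see, for each set, either both colours
or that the set is monochromatic. -/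
theorem exists_guess_of_chain (E : Finset V) (U : V → Finset V) (φ : V → Fin 3) (x y : Fin 3)
    (b : V) (hU : ∀ c ∈ E, ∀ d ∈ E, U c ⊆ U d ∨ U d ⊆ U c) (hne : ∀ c ∈ E, (U c).Nonempty)
    (hφ : ∀ c ∈ E, ∀ w ∈ U c, φ w = x ∨ φ w = y) :
    ∃ x' y' p q, ((x' = x ∧ y' = y) ∨ (x' = y ∧ y' = x)) ∧ (p = b ∨ φ p = x') ∧
      (q = b ∨ φ q = y') ∧ ∀ c ∈ E, p ∈ U c ∧ (q ∈ U c ∨ ∀ w ∈ U c, φ w = x') := by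
  classical
  rcases E.eq_empty_or_nonempty with rfl | hE
  · exact ⟨x, y, b, b, .inl ⟨rfl, rfl⟩, .inl rfl, .inl rfl, by simp⟩
  obtain ⟨c₀, hc₀, hmin⟩ := exists_subset_forall E U hE hU
  obtain ⟨p, hp⟩ := hne c₀ hc₀
  obtain ⟨x', y', hxy, hpx⟩ :
      ∃ x' y', ((x' = x ∧ y' = y) ∨ (x' = y ∧ y' = x)) ∧ φ p = x' := by
    rcases hφ c₀ hc₀ p hp with h | h
    · exact ⟨x, y, .inl ⟨rfl, rfl⟩, h⟩
    · exact ⟨y, x, .inr ⟨rfl, rfl⟩, h⟩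
  have hφ' : ∀ c ∈ E, ∀ w ∈ U c, φ w = x' ∨ φ w = y' := by
    intro c hc w hw
    rcases hxy with ⟨rfl, rfl⟩ | ⟨rfl, rfl⟩
    · exact hφ c hc w hw
    · exact (hφ c hc w hw).symm
  let F := E.filter fun c => ¬ ∀ w ∈ U c, φ w = x'
  rcases F.eq_empty_or_nonempty with hF | hF
  · refine ⟨x', y', p, b, hxy, .inr hpx, .inl rfl, fun c hc => ⟨hmin c hc hp, .inr ?_⟩⟩
    by_contra hcon
    have : c ∈ F := Finset.mem_filter.2 ⟨hc, hcon⟩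
    simp [hF] at this
  · obtain ⟨c₁, hc₁, hmin₁⟩ := exists_subset_forall F U hF fun c hc d hd =>
      hU c (Finset.mem_filter.1 hc).1 d (Finset.mem_filter.1 hd).1
    obtain ⟨hc₁E, hc₁F⟩ := Finset.mem_filter.1 hc₁
    push Not at hc₁F
    obtain ⟨q, hq, hqx⟩ := hc₁F
    refine ⟨x', y', p, q, hxy, .inr hpx, .inr ((hφ' c₁ hc₁E q hq).resolve_left hqx),
      fun c hc => ⟨hmin c hc hp, ?_⟩⟩
    by_cases hcon : ∀ w ∈ U c, φ w = x'
    · exact .inr hcon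
    · exact .inl (hmin₁ c (Finset.mem_filter.2 ⟨hc, hcon⟩) hq)

/-- The sets of neighbours that the two-vertex components of `C` have among vertices with a
common neighbour `b` outside form a chain. -/
theorem nbrs_of_edges_chain [Finite V] (G : SimpleGraph V)
    (h7 : ¬ (SimpleGraph.pathGraph 7).IsIndContained G)
    (h3 : ¬ (SimpleGraph.cycleGraph 3).IsIndContained G) (C S : Finset V) (U : V → Finset V)
    (hC : ∀ D : (G.induce (C : Set V)).ConnectedComponent, D.supp.ncard ≤ 2)
    (b : V) (hbS : ∀ w ∈ S, G.Adj b w) (hbC : ∀ c ∈ C, ¬ G.Adj b c)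
    (hU : ∀ c w, w ∈ U c ↔ w ∈ S ∧ (G.Adj c w ∨ ∃ d ∈ C, G.Adj c d ∧ G.Adj d w))
    {c₁ c₂ : V} (hc₁ : c₁ ∈ C) (hc₂ : c₂ ∈ C) (hd₁ : ∃ d ∈ C, G.Adj c₁ d)
    (hd₂ : ∃ d ∈ C, G.Adj c₂ d) : U c₁ ⊆ U c₂ ∨ U c₂ ⊆ U c₁ := by
  have huniq : ∀ u ∈ C, ∀ v ∈ C, ∀ w ∈ C, G.Adj u v → G.Adj v w → u = w :=
    fun u hu v hv w hw => eq_of_adj_of_adj G C hC hu hv hw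
  by_contra! hcon
  obtain ⟨⟨u, hu, hu'⟩, ⟨w, hw, hw'⟩⟩ := And.intro (Finset.not_subset.1 hcon.1)
    (Finset.not_subset.1 hcon.2)
  have hedge : ∀ c ∈ C, (∃ d ∈ C, G.Adj c d) → ∀ u ∈ U c, ∃ e ∈ C, ∃ e' ∈ C,
      G.Adj e e' ∧ G.Adj e u ∧ (e = c ∨ G.Adj c e) ∧ (e' = c ∨ G.Adj c e') := by
    rintro c hc ⟨d, hd, hcd⟩ u hu
    rcases ((hU c u).1 hu).2 with h | ⟨d', hd', h, h'⟩
    · exact ⟨c, hc, d, hd, hcd, h, .inl rfl, .inr hcd⟩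
    · exact ⟨d', hd', c, hc, h.symm, h', .inr h, .inl rfl⟩
  have hnot : ∀ c u, u ∈ S → u ∉ U c → ∀ e ∈ C, (e = c ∨ G.Adj c e) → ¬ G.Adj e u := by
    intro c u huS hu e he hce heu
    refine hu ((hU c u).2 ⟨huS, ?_⟩)
    rcases hce with rfl | hce
    · exact .inl heu
    · exact .inr ⟨e, he, hce, heu⟩
  have huS := ((hU _ _).1 hu).1
  have hwS := ((hU _ _).1 hw).1
  obtain ⟨e, he, e', he', hee, heu, hne, hne'⟩ := hedge c₁ hc₁ hd₁ u hu
  obtain ⟨f, hf, f', hf', hff, hfw, hnf, hnf'⟩ := hedge c₂ hc₂ hd₂ w hw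
  have hc : c₁ ≠ c₂ := fun h => hu' (h ▸ hu)
  have hc' : ¬ G.Adj c₁ c₂ := by
    intro h
    refine hnot c₂ u huS hu' e he ?_ heu
    rcases hne with rfl | hne
    · exact .inr h.symm
    · exact .inl (huniq c₂ hc₂ c₁ hc₁ e he h.symm hne).symm
  have hfar : ∀ e ∈ C, ∀ f ∈ C, (e = c₁ ∨ G.Adj c₁ e) → (f = c₂ ∨ G.Adj c₂ f) →
      ¬ G.Adj e f := by
    intro e he f hf he₁ hf₂ hef
    rcases he₁ with rfl | he₁
    · rcases hf₂ with rfl | hf₂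
      · exact hc' hef
      · exact hc (huniq _ he f hf c₂ hc₂ hef hf₂.symm)
    · rcases hf₂ with rfl | hf₂
      · exact hc (huniq c₁ hc₁ e he _ hf he₁ hef)
      · exact hc' ((huniq c₁ hc₁ e he f hf he₁ hef) ▸ hf₂.symm)
  exact no_private_neighbours G h7 h3 hee hff heu hfw (hbS u huS) (hbS w hwS)
    (hbC e he) (hbC e' he') (hbC f hf) (hbC f' hf')
    (hnot c₂ u huS hu' f hf hnf) (hnot c₂ u huS hu' f' hf' hnf')
    (hnot c₁ w hwS hw' e he hne) (hnot c₁ w hwS hw' e' he' hne')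
    (hfar e he f hf hne hnf) (hfar e he f' hf' hne hnf')
    (hfar e' he' f hf hne' hnf) (hfar e' he' f' hf' hne' hnf')

/-- Every colouring is captured by some guess, after recolouring isolated vertices of `G[C]`. -/
theorem exists_reduced_coloring [Finite V] (G : SimpleGraph V) (L : V → Finset (Fin 3))
    (A B C : Finset V)
    (h7 : ¬ (SimpleGraph.pathGraph 7).IsIndContained G)
    (h3 : ¬ (SimpleGraph.cycleGraph 3).IsIndContained G)
    (hV : ∀ v, v ∈ A ∨ v ∈ B ∨ v ∈ C) (hAC : Disjoint A C)
    (hBC : AnticompleteTo G (B : Set V) (C : Set V))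
    (hC : ∀ D : (G.induce (C : Set V)).ConnectedComponent, D.supp.ncard ≤ 2)
    (hCA : ∀ c ∈ C, ∃ a ∈ A, G.Adj c a) (hLA : ∀ a ∈ A, (L a).card ≤ 2)
    (hcomp : ∀ c₁ ∈ C, ∀ c₂ ∈ C, ∀ i j k : Fin 3, i ≠ j → i ≠ k → j ≠ k →
      CompleteTo G (nbrs G L A i j c₁ ∩ nonNbrs G L A i j c₂)
        (nonNbrs G L A i k c₁ ∩ nbrs G L A i k c₂))
    (hB : ∀ i j : Fin 3, i ≠ j → ∃ b ∈ B, CompleteTo G {b} (listClass L A {i, j}))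
    (φ : V → Fin 3) (hφ : ∀ u v, G.Adj u v → φ u ≠ φ v) (hφL : ∀ v, φ v ∈ L v) :
    ∃ (π : Pattern) (a : Fin 3 → V) (p q : V) (φ' : V → Fin 3),
      (∀ u v, G.Adj u v → φ' u ≠ φ' v) ∧ (∀ v, Reduced G L A C π a p q v (φ' v)) ∧
      ∀ v ∈ A, φ' v = φ v := by
  classical
  have hCB : ∀ b ∈ B, ∀ c ∈ C, ¬ G.Adj c b := fun b hb c hc h => hBC b hb c hc h.symm
  obtain ⟨b₀, hb₀, -⟩ := hB 0 1 (by decide)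
  choose σ hσ a ha ha' using
    exists_guess_of_color G L A C φ hφ hφL hcomp b₀ (hCB b₀ hb₀)
  -- Two of the three pairs of colours are of the form `{t, σ t}`.
  obtain ⟨x, y, z, hxy, hxz, hyz, hσx, hσy⟩ : ∃ x y z, x ≠ y ∧ x ≠ z ∧ y ≠ z ∧
      (σ x = z ∨ σ z = x) ∧ (σ y = z ∨ σ z = y) := by
    have hdec : ∀ s₀ s₁ s₂ : Fin 3, s₀ ≠ 0 → s₁ ≠ 1 → s₂ ≠ 2 → ∃ x y z : Fin 3,
        x ≠ y ∧ x ≠ z ∧ y ≠ z ∧ (![s₀, s₁, s₂] x = z ∨ ![s₀, s₁, s₂] z = x) ∧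
        (![s₀, s₁, s₂] y = z ∨ ![s₀, s₁, s₂] z = y) := by decide
    have hσ' : σ = ![σ 0, σ 1, σ 2] := by
      funext i
      fin_cases i <;> rfl
    rw [hσ']
    exact hdec _ _ _ (hσ 0) (hσ 1) (hσ 2)
  let Full : V → Prop := fun c => (∀ w ∈ A, G.Adj c w → ∀ i, L w ≠ {i}) ∧
    (∀ t, ¬ G.Adj c (a t)) ∧ ∀ t, ∀ w ∈ A, G.Adj c w → L w ≠ {t, σ t}
  have hFull : ∀ c, Full c → ∀ w ∈ A, G.Adj c w → L w = {x, y} := by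
    rintro c ⟨h₁, -, h₂⟩ w hw hcw
    have hdec : ∀ x y z : Fin 3, x ≠ y → x ≠ z → y ≠ z → ∀ S : Finset (Fin 3), S.Nonempty →
        S.card ≤ 2 → (∀ i, S ≠ {i}) → S = {x, y} ∨ (S = {x, z} ∧ S = {z, x}) ∨
        (S = {y, z} ∧ S = {z, y}) := by decide
    rcases hdec x y z hxy hxz hyz (L w) ⟨_, hφL w⟩ (hLA w hw) (h₁ w hw hcw) with
      h | ⟨h, h'⟩ | ⟨h, h'⟩
    · exact h
    · rcases hσx with hs | hs
      · exact absurd (hs ▸ h) (h₂ x w hw hcw)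
      · exact absurd (hs ▸ h') (h₂ z w hw hcw)
    · rcases hσy with hs | hs
      · exact absurd (hs ▸ h) (h₂ y w hw hcw)
      · exact absurd (hs ▸ h') (h₂ z w hw hcw)
  let S : Finset V := A.filter fun w => L w = {x, y}
  have hS : ∀ w, w ∈ S ↔ w ∈ A ∧ L w = {x, y} := fun w => by simp [S]
  let U : V → Finset V := fun c =>
    S.filter fun w => G.Adj c w ∨ ∃ d ∈ C, G.Adj c d ∧ G.Adj d w
  have hU : ∀ c w, w ∈ U c ↔ w ∈ S ∧ (G.Adj c w ∨ ∃ d ∈ C, G.Adj c d ∧ G.Adj d w) :=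
    fun c w => by simp [U]
  let E : Finset V := C.filter fun c => Full c ∧ ∃ d ∈ C, G.Adj c d
  have hE : ∀ c, c ∈ E ↔ c ∈ C ∧ Full c ∧ ∃ d ∈ C, G.Adj c d := fun c => by simp [E]
  have hSφ : ∀ w ∈ S, φ w = x ∨ φ w = y := by
    intro w hw
    have := hφL w
    rw [((hS w).1 hw).2] at this
    simpa using this
  obtain ⟨b, hb, hbS⟩ := hB x y hxy
  obtain ⟨x', y', p, q, hx'y', hp, hq, hpq⟩ := exists_guess_of_chain E U φ x y b₀
    (fun c hc d hd => by
      rw [hE] at hc hd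
      exact nbrs_of_edges_chain G h7 h3 C S U hC b
        (fun w hw => hbS b rfl w ((hS w).1 hw))
        (fun c hc => hBC b hb c hc) hU hc.1 hd.1 hc.2.2 hd.2.2)
    (fun c hc => by
      rw [hE] at hc
      obtain ⟨w, hw, hcw⟩ := hCA c hc.1
      exact ⟨w, (hU c w).2 ⟨(hS w).2 ⟨hw, hFull c hc.2.1 w hw hcw⟩, .inl hcw⟩⟩)
    (fun c _ w hw => hSφ w ((hU c w).1 hw).1)
  have hSz : ∀ w ∈ S, φ w ≠ z := by
    intro w hw h
    rcases hSφ w hw with h' | h'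
    · exact hxz (h' ▸ h)
    · exact hyz (h' ▸ h)
  have hx'z : ∀ i : Fin 3, i ≠ x' → i ≠ y' → i = z := by
    have hdec : ∀ x y z : Fin 3, x ≠ y → x ≠ z → y ≠ z → ∀ i, i ≠ x → i ≠ y → i = z := by
      decide
    rcases hx'y' with ⟨rfl, rfl⟩ | ⟨rfl, rfl⟩
    · exact hdec _ _ _ hxy hxz hyz
    · exact hdec _ _ _ hxy.symm hyz hxz
  have hpC : ∀ c ∈ C, G.Adj c p → φ c ≠ x' := by
    intro c hc hcp
    rcases hp with rfl | rfl
    · exact absurd hcp (hCB _ hb₀ c hc)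
    · exact hφ c p hcp
  have hqC : ∀ c ∈ C, G.Adj c q → φ c ≠ y' := by
    intro c hc hcq
    rcases hq with rfl | rfl
    · exact absurd hcq (hCB _ hb₀ c hc)
    · exact hφ c q hcq
  let π : Pattern := (σ, x', y', z)
  have hexcl : ∀ c ∈ C, ¬ Excluded G L A π a p q c (φ c) := by
    rintro c hc (⟨w, hw, hcw, hL⟩ | h | ⟨t, ht, hct, w, hw, hcw, hL⟩ | ⟨h, h'⟩ | ⟨h, h'⟩)
    · have := hφL w
      rw [hL, Finset.mem_singleton] at this
      exact hφ c w hcw this.symm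
    · exact ha _ c hc h rfl
    · have ht' : σ t = φ c := ht
      exact hφ c w hcw ((ha' t c hc hct w hw hcw (ht' ▸ hL)).trans ht').symm
    · exact hpC c hc h' h
    · exact hqC c hc h' h
  have hfull : ∀ c, (∀ j, ¬ Excluded G L A π a p q c j) →
      Full c ∧ ¬ G.Adj c p ∧ ¬ G.Adj c q := by
    intro c h
    refine ⟨⟨fun w hw hcw i hL => h i (.inl ⟨w, hw, hcw, hL⟩), fun t ht => h t (.inr (.inl ht)),
      fun t w hw hcw hL => ?_⟩, fun hcp => h x' (.inr (.inr (.inr (.inl ⟨rfl, hcp⟩)))),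
      fun hcq => h y' (.inr (.inr (.inr (.inr ⟨rfl, hcq⟩))))⟩
    exact h (σ t) (.inr (.inr (.inl ⟨t, rfl, fun ht => h t (.inr (.inl ht)), w, hw, hcw, hL⟩)))
  let Free : V → Prop := fun c =>
    c ∈ C ∧ (∀ j, ¬ Excluded G L A π a p q c j) ∧ ¬ ∃ w ∈ C, G.Adj c w
  -- A neighbour of a recoloured vertex lies in `S`, so its colour is not `z`.
  have hfree : ∀ u v, G.Adj u v → Free u → v ∈ S := by
    rintro u v huv ⟨hu, hu', hu''⟩
    rcases hV v with hv | hv | hv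
    · exact (hS v).2 ⟨hv, hFull u (hfull u hu').1 v hv huv⟩
    · exact absurd huv (hCB v hv u hu)
    · exact absurd ⟨v, hv, huv⟩ hu''
  have hSfree : ∀ v ∈ A, ¬ Free v := fun v hv h => Finset.disjoint_left.1 hAC hv h.1
  refine ⟨π, a, p, q, fun v => if Free v then z else φ v, ?_, ?_, ?_⟩
  · intro u v huv
    by_cases hu : Free u
    · have hv := hfree u v huv hu
      simp only [hu, hSfree v ((hS v).1 hv).1, if_true, if_false]
      exact (hSz v hv).symm
    · by_cases hv : Free v
      · simp only [hu, hv, if_true, if_false]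
        exact hSz u (hfree v u huv.symm hv)
      · simp only [hu, hv, if_false]
        exact hφ u v huv
  · intro v
    by_cases hvC : v ∈ C
    swap
    · have : ¬ Free v := fun h => hvC h.1
      simp only [this, if_false]
      exact .inl ⟨hvC, hφL v⟩
    by_cases hv : Free v
    · simp only [hv, if_true]
      exact .inr ⟨hvC, .inr (.inl ⟨hv.2.1, .inl ⟨hv.2.2, rfl⟩⟩)⟩
    simp only [hv, if_false]
    refine .inr ⟨hvC, .inr ?_⟩
    by_cases hex : ∃ j, Excluded G L A π a p q v j
    · exact .inr ⟨hex, hexcl v hvC⟩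
    have hex' := not_exists.1 hex
    obtain ⟨hvF, hvp, hvq⟩ := hfull v hex'
    have hd : ∃ d ∈ C, G.Adj v d := by
      by_contra h
      exact hv ⟨hvC, hex', h⟩
    obtain ⟨hpU, hqU⟩ := hpq v ((hE v).2 ⟨hvC, hvF, hd⟩)
    obtain ⟨d, hdC, hvd, hdp⟩ := ((hU v p).1 hpU).2.resolve_left hvp
    refine .inl ⟨hex', .inr ?_⟩
    by_cases hdq : ∃ w ∈ C, G.Adj v w ∧ G.Adj w q
    · refine .inl ⟨hdq, fun hvz => ?_⟩
      obtain ⟨w, hw, hvw, hwq⟩ := hdq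
      -- The vertex `v` has only one neighbour in `C`, which sees both colours `x'` and `y'`.
      have hdw : d = w := eq_of_adj_of_adj G C hC hdC hvC hw hvd.symm hvw
      subst hdw
      exact hφ v d hvd (hvz.trans (hx'z _ (hpC d hdC hdp) (hqC d hdC hwq)).symm)
    · refine .inr ⟨hd, hdq, fun hvx => ?_⟩
      rcases hqU with h | h
      · rcases ((hU v q).1 h).2 with h | ⟨w, hw, h⟩
        · exact hvq h
        · exact hdq ⟨w, hw, h⟩
      · obtain ⟨w, hw, hvw⟩ := hCA v hvC
        refine hφ v w hvw (hvx.trans (h w ((hU v w).2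
          ⟨(hS w).2 ⟨hw, hFull v hvF w hw hvw⟩, .inl hvw⟩)).symm)
  · intro v hv
    simp only [hSfree v hv, if_false]

end ListColoring

namespace RAM

/-! ### Running programs -/

/-- Started in `s`, the program `p` halts within `T` steps in a state satisfying `Q`. -/
def Runs (p : Cmd) (s : State) (T : ℕ) (Q : State → Prop) : Prop :=
  ∃ s' t, Exec p s s' t ∧ t ≤ T ∧ Q s'

theorem Runs.mono {p : Cmd} {s : State} {T T' : ℕ} {Q Q' : State → Prop} (h : Runs p s T Q)
    (hT : T ≤ T') (hQ : ∀ s', Q s' → Q' s') : Runs p s T' Q' := by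
  obtain ⟨s', t, h₁, h₂, h₃⟩ := h
  exact ⟨s', t, h₁, h₂.trans hT, hQ s' h₃⟩

theorem Runs.seq {p q : Cmd} {s : State} {T₁ T₂ : ℕ} {R Q : State → Prop} (hp : Runs p s T₁ R)
    (hq : ∀ s', R s' → Runs q s' T₂ Q) : Runs (.seq p q) s (T₁ + T₂) Q := by
  obtain ⟨s₁, t₁, h₁, h₂, h₃⟩ := hp
  obtain ⟨s₂, t₂, h₄, h₅, h₆⟩ := hq s₁ h₃
  exact ⟨s₂, _, .seq h₁ h₄, add_le_add h₂ h₅, h₆⟩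

theorem Runs.branch {b : Test} {p q : Cmd} {s : State} {T : ℕ} {Q : State → Prop}
    (hp : b.Holds s → Runs p s T Q) (hq : ¬ b.Holds s → Runs q s T Q) :
    Runs (.branch b p q) s (T + 1) Q := by
  by_cases hb : b.Holds s
  · obtain ⟨s', t, h₁, h₂, h₃⟩ := hp hb
    exact ⟨s', _, .branchTrue hb h₁, Nat.succ_le_succ h₂, h₃⟩
  · obtain ⟨s', t, h₁, h₂, h₃⟩ := hq hb
    exact ⟨s', _, .branchFalse hb h₁, Nat.succ_le_succ h₂, h₃⟩

theorem Runs.skip {s : State} {T : ℕ} {Q : State → Prop} (h : Q s) : Runs .skip s T Q :=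
  ⟨s, 0, .skip s, Nat.zero_le _, h⟩

theorem Runs.const {s : State} {x k : ℕ} {Q : State → Prop} (h : Q (s.setVar x k)) :
    Runs (.const x k) s 1 Q :=
  ⟨_, 1, .const s x k, le_rfl, h⟩

theorem Runs.copy {s : State} {x y : ℕ} {Q : State → Prop} (h : Q (s.setVar x (s.var y))) :
    Runs (.copy x y) s 1 Q :=
  ⟨_, 1, .copy s x y, le_rfl, h⟩

theorem Runs.succ {s : State} {x y : ℕ} {Q : State → Prop}
    (h : Q (s.setVar x (s.var y + 1))) : Runs (.succ x y) s 1 Q :=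
  ⟨_, 1, .succ s x y, le_rfl, h⟩

theorem Runs.load {s : State} {x a : ℕ} {idx : List ℕ} {Q : State → Prop}
    (h : Q (s.setVar x (s.arr a (idx.map s.var)))) : Runs (.load x a idx) s 1 Q :=
  ⟨_, 1, .load s x a idx, le_rfl, h⟩

theorem Runs.store {s : State} {a y : ℕ} {idx : List ℕ} {Q : State → Prop}
    (h : Q (s.setArr a (idx.map s.var) (s.var y))) : Runs (.store a idx y) s 1 Q :=
  ⟨_, 1, .store s a idx y, le_rfl, h⟩

@[simp] theorem State.setVar_arr (s : State) (x k : ℕ) : (s.setVar x k).arr = s.arr := rfl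

@[simp] theorem State.setArr_var (s : State) (a : ℕ) (idx : List ℕ) (k : ℕ) :
    (s.setArr a idx k).var = s.var := rfl

@[simp] theorem State.setVar_var_self (s : State) (x k : ℕ) : (s.setVar x k).var x = k := by
  simp [State.setVar]

theorem State.setVar_var_of_ne (s : State) {x y : ℕ} (k : ℕ) (h : y ≠ x) :
    (s.setVar x k).var y = s.var y := by
  simp [State.setVar, h]

theorem State.setArr_arr_of_ne (s : State) {a b : ℕ} (idx : List ℕ) (k : ℕ) (h : b ≠ a) :
    (s.setArr a idx k).arr b = s.arr b := by
  simp [State.setArr, h]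

theorem State.setArr_arr_same (s : State) (a : ℕ) (idx idx' : List ℕ) (k : ℕ) :
    (s.setArr a idx k).arr a idx' = if idx' = idx then k else s.arr a idx' := by
  simp [State.setArr, Function.update_apply]

/-- Runs `p` once for each value of the variable `x` below the value of the variable `0`. -/
def forVar (x : ℕ) (p : Cmd) : Cmd :=
  .seq (.const x 0) (.loop (.lt x 0) (.seq p (.succ x x)))

/-- The loop rule: `I k` is an invariant that holds when the loop variable has reached `k`. -/
theorem runs_loop {x n T : ℕ} {p : Cmd} (I : ℕ → State → Prop)
    (hI : ∀ k s, I k s → s.var x = k ∧ s.var 0 = n)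
    (hstep : ∀ k < n, ∀ s, I k s →
      Runs p s T fun s' => I (k + 1) (s'.setVar x (s'.var x + 1))) :
    ∀ m k s, k + m = n → I k s →
      Runs (.loop (.lt x 0) (.seq p (.succ x x))) s (m * (T + 2) + 1) (I n) := by
  intro m
  induction m with
  | zero =>
    intro k s hk hs
    obtain ⟨h₁, h₂⟩ := hI k s hs
    refine ⟨s, 1, .loopFalse ?_, by simp, by simpa [← hk] using hs⟩
    simp [Test.Holds, h₁, h₂, ← hk]
  | succ m ih =>
    intro k s hk hs
    obtain ⟨h₁, h₂⟩ := hI k s hs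
    obtain ⟨s₁, t₁, h₃, h₄, h₅⟩ := hstep k (by omega) s hs
    obtain ⟨s₂, t₂, h₆, h₇, h₈⟩ := ih (k + 1) _ (by omega) h₅
    refine ⟨s₂, _, .loopTrue ?_ (.seq h₃ (.succ _ _ _)) h₆, ?_, h₈⟩
    · simp [Test.Holds, h₁, h₂]
      omega
    · rw [Nat.succ_mul]
      omega

theorem runs_forVar {x n T : ℕ} {p : Cmd} {s : State} (I : ℕ → State → Prop)
    (hI : ∀ k s, I k s → s.var x = k ∧ s.var 0 = n) (h0 : I 0 (s.setVar x 0))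
    (hstep : ∀ k < n, ∀ s, I k s →
      Runs p s T fun s' => I (k + 1) (s'.setVar x (s'.var x + 1))) :
    Runs (forVar x p) s (n * (T + 2) + 2) (I n) :=
  Runs.mono (Runs.seq (T₁ := 1) (R := I 0) (Runs.const h0) fun s' hs' =>
    runs_loop I hI hstep n 0 s' (by omega) hs') (by omega) fun _ h => h

/-! ### Deciding formulas

Formulas with bounded quantifiers over the vertices are compiled to programs.  The truth value
of a formula is left in the variable `60`; quantifiers use the loop variable `61` and the
variable `63`; the variable `62` is expected to hold `1`. -/

/-- Formulas over the arrays.  `atom a idx` says that the entry of the array `a` at the values of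
the variables `idx` is `1`, and `ex φ` quantifies over values of the variable `61` below the number
of vertices. -/
inductive Fm
  | lit (b : Bool)
  | atom (a : ℕ) (idx : List ℕ)
  | not (φ : Fm)
  | and (φ ψ : Fm)
  | ex (φ : Fm)

/-- The truth of a formula for `n` vertices, the memory `M` and the values `ν` of the variables. -/
def Fm.Sem (n : ℕ) (M : ℕ → List ℕ → ℕ) : Fm → (ℕ → ℕ) → Prop
  | .lit b, _ => b = true
  | .atom a idx, ν => M a (idx.map ν) = 1
  | .not φ, ν => ¬ φ.Sem n M ν
  | .and φ ψ, ν => φ.Sem n M ν ∧ ψ.Sem n M ν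
  | .ex φ, ν => ∃ k < n, φ.Sem n M (Function.update ν 61 k)

theorem Fm.sem_ex {n : ℕ} {M : ℕ → List ℕ → ℕ} {φ : Fm} {ν : ℕ → ℕ} :
    (Fm.ex φ).Sem n M ν ↔ ∃ w : Fin n, φ.Sem n M (Function.update ν 61 w) :=
  ⟨fun ⟨k, hk, h⟩ => ⟨⟨k, hk⟩, h⟩, fun ⟨w, h⟩ => ⟨w, w.2, h⟩⟩

/-- The formula reads arrays `0` to `4` and variables below `60` only, apart from the variable `61`
inside a quantifier, and quantifiers are not nested; `b` tells whether the formula stands inside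
a quantifier. -/
def Fm.Scoped : Bool → Fm → Prop
  | _, .lit _ => True
  | b, .atom a idx => a ≤ 4 ∧ ∀ x ∈ idx, x < 60 ∨ (b = true ∧ x = 61)
  | b, .not φ => φ.Scoped b
  | b, .and φ ψ => φ.Scoped b ∧ ψ.Scoped b
  | b, .ex φ => b = false ∧ φ.Scoped true

theorem Fm.sem_congr {n : ℕ} {M : ℕ → List ℕ → ℕ} (φ : Fm) (b : Bool) (hφ : φ.Scoped b)
    {ν ν' : ℕ → ℕ} (h : ∀ x < 60, ν x = ν' x) (h' : b = true → ν 61 = ν' 61) :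
    φ.Sem n M ν ↔ φ.Sem n M ν' := by
  induction φ generalizing b ν ν' with
  | lit c => rfl
  | atom a idx =>
    have : idx.map ν = idx.map ν' := by
      refine List.map_congr_left fun x hx => ?_
      rcases hφ.2 x hx with h₁ | ⟨h₁, rfl⟩
      · exact h x h₁
      · exact h' h₁
    simp only [Fm.Sem, this]
  | not φ ih => exact not_congr (ih b hφ h h')
  | and φ ψ ih₁ ih₂ => exact and_congr (ih₁ b hφ.1 h h') (ih₂ b hφ.2 h h')
  | ex φ ih =>
    refine exists_congr fun k => and_congr_right fun _ => ih true hφ.2 (fun x hx => ?_) ?_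
    · rw [Function.update_of_ne (by omega), Function.update_of_ne (by omega)]
      exact h x hx
    · simp

/-- The program deciding a formula. -/
def Fm.comp : Fm → Cmd
  | .lit b => .const 60 b.toNat
  | .atom a idx => .seq (.load 60 a idx) (.branch (.eq 60 62) .skip (.const 60 0))
  | .not φ => .seq φ.comp (.branch (.eq 60 62) (.const 60 0) (.const 60 1))
  | .and φ ψ => .seq φ.comp (.branch (.eq 60 62) ψ.comp .skip)
  | .ex φ => .seq (.const 63 0) (.seq
      (forVar 61 (.seq φ.comp (.branch (.eq 60 62) (.const 63 1) .skip))) (.copy 60 63))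

/-- The running time of `φ.comp` is at most `φ.cost` outside quantified formulas and `φ.cost * n`
otherwise. -/
def Fm.cost : Fm → ℕ
  | .lit _ => 1
  | .atom _ _ => 3
  | .not φ => φ.cost + 2
  | .and φ ψ => φ.cost + ψ.cost + 1
  | .ex φ => φ.cost + 8

theorem Fm.runs {n : ℕ} {M : ℕ → List ℕ → ℕ} (hn : 1 ≤ n) (φ : Fm) (b : Bool) (hφ : φ.Scoped b)
    (s : State) (h0 : s.var 0 = n) (h62 : s.var 62 = 1) (hM : ∀ a ≤ 4, s.arr a = M a) :
    Runs φ.comp s (φ.cost * if b then 1 else n) fun s' =>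
      s'.var 60 = ListColoring.bit (φ.Sem n M s.var) ∧ s'.arr = s.arr ∧
      ∀ x, x ≠ 60 → (b = false → x ≠ 61 ∧ x ≠ 63) → s'.var x = s.var x := by
  classical
  have hm : 1 ≤ if b = true then 1 else n := by split_ifs <;> omega
  induction φ generalizing b s with
  | lit c =>
    refine Runs.mono (T := 1) (Runs.const ⟨?_, rfl, fun x hx _ => s.setVar_var_of_ne _ hx⟩)
      (by simpa [Fm.cost] using hm) fun _ h => h
    cases c <;> simp [Fm.Sem, ListColoring.bit]
  | atom a idx =>
    have hMa := hM a hφ.1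
    refine Runs.mono (T := 1 + (1 + 1)) (Runs.seq (Runs.load rfl) ?_)
      (by simp only [Fm.cost]; omega) fun _ h => h
    rintro s' rfl
    have h62' : (s.setVar 60 (s.arr a (idx.map s.var))).var 62 = 1 := by
      rw [State.setVar_var_of_ne _ _ (by decide), h62]
    refine Runs.branch (fun hb => Runs.skip ?_) (fun hb => Runs.const ?_)
    · simp only [Test.Holds, h62', State.setVar_var_self] at hb
      refine ⟨?_, rfl, fun x hx _ => s.setVar_var_of_ne _ hx⟩
      rw [State.setVar_var_self, hb, ListColoring.bit, if_pos]
      rw [Fm.Sem, ← hMa, hb]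
    · simp only [Test.Holds, h62', State.setVar_var_self] at hb
      refine ⟨?_, rfl, fun x hx _ => ?_⟩
      · rw [State.setVar_var_self, ListColoring.bit, if_neg]
        rw [Fm.Sem, ← hMa]
        exact hb
      · rw [State.setVar_var_of_ne _ _ hx, State.setVar_var_of_ne _ _ hx]
  | not φ ih =>
    refine Runs.mono (Runs.seq (ih b hφ s h0 h62 hM hm) (T₂ := 1 + 1) ?_)
      (by simp only [Fm.cost, add_mul]; omega) fun _ h => h
    rintro s' ⟨h₁, h₂, h₃⟩
    have h62' : s'.var 62 = 1 := by rw [h₃ 62 (by decide) fun _ => by decide, h62]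
    refine Runs.branch (fun hb => Runs.const ?_) (fun hb => Runs.const ?_)
    all_goals
      simp only [Test.Holds, h62', h₁, ListColoring.bit] at hb
      refine ⟨?_, h₂, fun x hx hx' => (s'.setVar_var_of_ne _ hx).trans (h₃ x hx hx')⟩
      by_cases h : φ.Sem n M s.var <;> simp_all [Fm.Sem, ListColoring.bit]
  | and φ ψ ih₁ ih₂ =>
    refine Runs.mono (Runs.seq (ih₁ b hφ.1 s h0 h62 hM hm)
      (T₂ := (ψ.cost * if b then 1 else n) + 1) ?_)
      (by simp only [Fm.cost, add_mul]; omega) fun _ h => h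
    rintro s' ⟨h₁, h₂, h₃⟩
    have h62' : s'.var 62 = 1 := by rw [h₃ 62 (by decide) fun _ => by decide, h62]
    have h0' : s'.var 0 = n := by rw [h₃ 0 (by decide) fun _ => by decide, h0]
    have hψ : ψ.Sem n M s'.var ↔ ψ.Sem n M s.var := by
      refine ψ.sem_congr b hφ.2 (fun x hx => h₃ x (by omega) fun _ => by omega) ?_
      rintro rfl
      exact h₃ 61 (by decide) (by decide)
    refine Runs.branch (fun hb => ?_) (fun hb => Runs.skip ?_)
    · refine Runs.mono (ih₂ b hφ.2 s' h0' h62' (fun a ha => by rw [h₂, hM a ha]) hm) le_rfl ?_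
      rintro s'' ⟨h₄, h₅, h₆⟩
      refine ⟨?_, h₅.trans h₂, fun x hx hx' => (h₆ x hx hx').trans (h₃ x hx hx')⟩
      simp only [Test.Holds, h62', h₁, ListColoring.bit] at hb
      by_cases h : φ.Sem n M s.var
      · simp [h₄, Fm.Sem, hψ, h]
      · simp [h] at hb
    · refine ⟨?_, h₂, h₃⟩
      simp only [Test.Holds, h62', h₁, ListColoring.bit] at hb
      by_cases h : φ.Sem n M s.var
      · simp [h] at hb
      · simp [h₁, Fm.Sem, h, ListColoring.bit]
  | ex φ ih =>
    obtain ⟨rfl, hφ⟩ := hφ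
    let I : ℕ → State → Prop := fun k s' =>
      s'.var 61 = k ∧ s'.var 63 = ListColoring.bit
        (∃ j < k, φ.Sem n M (Function.update s.var 61 j)) ∧ s'.arr = s.arr ∧
      ∀ x, x ≠ 60 → x ≠ 61 → x ≠ 63 → s'.var x = s.var x
    refine Runs.mono (Runs.seq (T₁ := 1) (Runs.const rfl)
      (T₂ := n * ((φ.cost + (0 + 1 + 1)) + 2) + 2 + 1) ?_) ?_ fun _ h => h
    swap
    · simp only [Fm.cost, Bool.false_eq_true, if_false]
      nlinarith
    rintro s₁ rfl
    refine Runs.seq (runs_forVar I (n := n) (fun k s' h => ⟨h.1, ?_⟩) ⟨by simp, ?_, rfl, ?_⟩ ?_) ?_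
    · rw [h.2.2.2 0 (by decide) (by decide) (by decide), h0]
    · simp [State.setVar, ListColoring.bit]
    · intro x _ h₂ h₃
      rw [State.setVar_var_of_ne _ _ h₂, State.setVar_var_of_ne _ _ h₃]
    · rintro k - s₂ ⟨h₁, h₂, h₃, h₄⟩
      have h62' : s₂.var 62 = 1 := by rw [h₄ 62 (by decide) (by decide) (by decide), h62]
      have h0' : s₂.var 0 = n := by rw [h₄ 0 (by decide) (by decide) (by decide), h0]
      have hφk : φ.Sem n M s₂.var ↔ φ.Sem n M (Function.update s.var 61 k) := by
        refine φ.sem_congr true hφ (fun x hx => ?_) fun _ => by simpa using h₁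
        rw [Function.update_of_ne (by omega)]
        exact h₄ x (by omega) (by omega) (by omega)
      have hk : (∃ j < k + 1, φ.Sem n M (Function.update s.var 61 j)) ↔
          (∃ j < k, φ.Sem n M (Function.update s.var 61 j)) ∨
            φ.Sem n M (Function.update s.var 61 k) := by
        constructor
        · rintro ⟨j, hj, h⟩
          rcases Nat.lt_succ_iff_lt_or_eq.1 hj with hj | rfl
          · exact .inl ⟨j, hj, h⟩
          · exact .inr h
        · rintro (⟨j, hj, h⟩ | h)
          · exact ⟨j, by omega, h⟩
          · exact ⟨k, by omega, h⟩
      have hrun := ih true hφ s₂ h0' h62' (fun a ha => by rw [h₃, hM a ha]) le_rfl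
      simp only [if_true, mul_one] at hrun
      refine Runs.seq hrun ?_
      rintro s₃ ⟨h₅, h₆, h₇⟩
      have h62'' : s₃.var 62 = 1 := by rw [h₇ 62 (by decide) (by decide), h62']
      rw [hφk] at h₅
      refine Runs.branch (T := 0 + 1) (fun hb => Runs.const ?_) (fun hb => Runs.skip ?_)
      all_goals simp only [Test.Holds, h62'', h₅, ListColoring.bit] at hb
      · have h : φ.Sem n M (Function.update s.var 61 k) := by
          by_contra h
          simp [h] at hb
        refine ⟨?_, ?_, h₆.trans h₃, fun x hx hx' hx'' => ?_⟩
        · simp [State.setVar, h₇ 61, h₁]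
        · rw [hk]
          simp [State.setVar, ListColoring.bit, h]
        · rw [State.setVar_var_of_ne _ _ hx', State.setVar_var_of_ne _ _ hx'',
            h₇ x hx (by simp), h₄ x hx hx' hx'']
      · have h : ¬ φ.Sem n M (Function.update s.var 61 k) := by
          intro h
          simp [h] at hb
        refine ⟨?_, ?_, h₆.trans h₃, fun x hx hx' hx'' => ?_⟩
        · simp [h₇ 61, h₁]
        · rw [hk, State.setVar_var_of_ne _ _ (by decide), h₇ 63 (by decide) (by simp), h₂]
          simp [h]
        · rw [State.setVar_var_of_ne _ _ hx', h₇ x hx (by simp), h₄ x hx hx' hx'']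
    · rintro s₂ ⟨-, h₂, h₃, h₄⟩
      refine Runs.copy ⟨by rw [State.setVar_var_self, h₂]; rfl, h₃, fun x hx hx' => ?_⟩
      rw [State.setVar_var_of_ne _ _ hx, h₄ x hx (hx' rfl).1 (hx' rfl).2]

end RAM

namespace ListColoring

open RAM

/-! ### The formula for the reduced lists

The variables `10`, `11`, `12` hold the vertices guessed for the three colours, `13` and `14` the
guesses `p` and `q`, `15` the current vertex, and `20`, `21`, `22` the three colours. -/

theorem bit_eq_one {p : Prop} : bit p = 1 ↔ p := by
  by_cases h : p <;> simp [bit, h]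

/-- Disjunction; universal and existential quantifiers over the three colours are unfolded. -/
def orFm (φ ψ : Fm) : Fm := .not (.and (.not φ) (.not ψ))

def allColors (f : Fin 3 → Fm) : Fm := .and (f 0) (.and (f 1) (f 2))

def anyColor (f : Fin 3 → Fm) : Fm := orFm (f 0) (orFm (f 1) (f 2))

/-- The vertex in the variable `x` has the list `S`. -/
def listIsFm (x : ℕ) (S : Finset (Fin 3)) : Fm :=
  allColors fun j => if j ∈ S then .atom 1 [x, 20 + j] else .not (.atom 1 [x, 20 + j])

/-- The current vertex has a neighbour in `A` with list `S`. -/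
def hasNbrFm (S : Finset (Fin 3)) : Fm :=
  .ex (.and (.atom 2 [61]) (.and (.atom 0 [15, 61]) (listIsFm 61 S)))

/-- The formula for `Excluded`. -/
def excludedFm (π : Pattern) (i : Fin 3) : Fm :=
  orFm (hasNbrFm {i}) <| orFm (.atom 0 [15, 10 + i]) <|
  orFm (anyColor fun t => .and (.lit (decide (π.1 t = i)))
    (.and (.not (.atom 0 [15, 10 + t])) (hasNbrFm {t, i}))) <|
  orFm (.and (.lit (decide (i = π.2.1))) (.atom 0 [15, 13]))
    (.and (.lit (decide (i = π.2.2.1))) (.atom 0 [15, 14]))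

/-- The current vertex has a neighbour in `C`. -/
def hasPartnerFm : Fm := .ex (.and (.atom 4 [61]) (.atom 0 [15, 61]))

/-- The current vertex has a neighbour in `C` adjacent to the guess `q`. -/
def partnerSeesFm : Fm := .ex (.and (.atom 4 [61]) (.and (.atom 0 [15, 61]) (.atom 0 [61, 14])))

/-- The formula for `Reduced`. -/
def reducedFm (π : Pattern) (i : Fin 3) : Fm :=
  orFm (.and (.not (.atom 4 [15])) (.atom 1 [15, 20 + i])) <| .and (.atom 4 [15]) <|
    orFm (.and (allColors (excludedFm π)) (.lit (decide (i = π.2.2.2)))) <|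
    orFm (.and (allColors fun j => .not (excludedFm π j)) <|
      orFm (.and (.not hasPartnerFm) (.lit (decide (i = π.2.2.2)))) <|
      orFm (.and partnerSeesFm (.lit (decide (i ≠ π.2.2.2))))
        (.and hasPartnerFm (.and (.not partnerSeesFm) (.lit (decide (i ≠ π.2.1)))))) <|
    .and (anyColor (excludedFm π)) (.not (excludedFm π i))

theorem scoped_orFm {b : Bool} {φ ψ : Fm} (h₁ : φ.Scoped b) (h₂ : ψ.Scoped b) :
    (orFm φ ψ).Scoped b := ⟨h₁, h₂⟩

theorem scoped_listIsFm (S : Finset (Fin 3)) : (listIsFm 61 S).Scoped true := by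
  have h : ∀ j : Fin 3, (if j ∈ S then Fm.atom 1 [61, 20 + j]
      else .not (.atom 1 [61, 20 + j])).Scoped true := by
    intro j
    split_ifs <;> simp [Fm.Scoped] <;> omega
  exact ⟨h 0, h 1, h 2⟩

theorem scoped_hasNbrFm (S : Finset (Fin 3)) : (hasNbrFm S).Scoped false :=
  ⟨rfl, by simp [Fm.Scoped], by simp [Fm.Scoped], scoped_listIsFm S⟩

theorem scoped_excludedFm (π : Pattern) (i : Fin 3) : (excludedFm π i).Scoped false := by
  have h : ∀ j : Fin 3, (Fm.atom 0 [15, 10 + j]).Scoped false := by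
    intro j
    simp [Fm.Scoped]
    omega
  have h' : ∀ t : Fin 3, (Fm.and (.lit (decide (π.1 t = i)))
      (.and (.not (.atom 0 [15, 10 + t])) (hasNbrFm {t, i}))).Scoped false :=
    fun t => ⟨trivial, h t, scoped_hasNbrFm _⟩
  exact scoped_orFm (scoped_hasNbrFm _) <| scoped_orFm (h i) <|
    scoped_orFm (scoped_orFm (h' 0) (scoped_orFm (h' 1) (h' 2))) <|
    scoped_orFm ⟨trivial, by simp [Fm.Scoped]⟩ ⟨trivial, by simp [Fm.Scoped]⟩

theorem scoped_reducedFm (π : Pattern) (i : Fin 3) : (reducedFm π i).Scoped false := by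
  have hi : (Fm.atom 1 [15, 20 + i]).Scoped false := by
    simp [Fm.Scoped]
    omega
  have he := scoped_excludedFm π
  have hC : (Fm.atom 4 [15]).Scoped false := by simp [Fm.Scoped]
  have h₁ : hasPartnerFm.Scoped false := by simp [hasPartnerFm, Fm.Scoped]
  have h₂ : partnerSeesFm.Scoped false := by simp [partnerSeesFm, Fm.Scoped]
  exact scoped_orFm ⟨hC, hi⟩ ⟨hC, scoped_orFm ⟨⟨he 0, he 1, he 2⟩, trivial⟩ <|
    scoped_orFm ⟨⟨he 0, he 1, he 2⟩, scoped_orFm ⟨h₁, trivial⟩ <|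
      scoped_orFm ⟨h₂, trivial⟩ ⟨h₁, h₂, trivial⟩⟩
    ⟨scoped_orFm (he 0) (scoped_orFm (he 1) (he 2)), he i⟩⟩

theorem sem_orFm {n : ℕ} {M : ℕ → List ℕ → ℕ} {φ ψ : Fm} {ν : ℕ → ℕ} :
    (orFm φ ψ).Sem n M ν ↔ φ.Sem n M ν ∨ ψ.Sem n M ν := by
  simp only [orFm, Fm.Sem]
  tauto

theorem sem_allColors {n : ℕ} {M : ℕ → List ℕ → ℕ} {f : Fin 3 → Fm} {ν : ℕ → ℕ} :
    (allColors f).Sem n M ν ↔ ∀ i, (f i).Sem n M ν := by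
  simp only [allColors, Fm.Sem, Fin.forall_fin_succ, IsEmpty.forall_iff, and_true]
  rfl

theorem sem_anyColor {n : ℕ} {M : ℕ → List ℕ → ℕ} {f : Fin 3 → Fm} {ν : ℕ → ℕ} :
    (anyColor f).Sem n M ν ↔ ∃ i, (f i).Sem n M ν := by
  simp only [anyColor, sem_orFm, Fin.exists_fin_succ, IsEmpty.exists_iff, or_false]
  rfl

section Input

variable {n : ℕ} {G : SimpleGraph (Fin n)} {L : Fin n → Finset (Fin 3)} {A B C : Finset (Fin n)}
  {zs : List (Finset (Fin n))}

theorem input_adj (u v : Fin n) : (inputState G L A B C zs).arr 0 [u, v] = 1 ↔ G.Adj u v := by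
  simp [inputState, bit_eq_one]

theorem input_list (v : Fin n) (i : Fin 3) :
    (inputState G L A B C zs).arr 1 [v, i] = 1 ↔ i ∈ L v := by
  simp [inputState, bit_eq_one]

theorem input_A (v : Fin n) : (inputState G L A B C zs).arr 2 [v] = 1 ↔ v ∈ A := by
  simp [inputState, bit_eq_one, MemWord]

theorem input_C (v : Fin n) : (inputState G L A B C zs).arr 4 [v] = 1 ↔ v ∈ C := by
  simp [inputState, bit_eq_one, MemWord]

/-- The assignment `ν` of the variables holds the current vertex `v`, the guessed vertices `g` and
the three colours. -/
structure Assigns (ν : ℕ → ℕ) (g : ℕ → Fin n) (v : Fin n) : Prop where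
  cur : ν 15 = v
  guess : ∀ x, 10 ≤ x → x < 15 → ν x = g x
  color : ∀ i : Fin 3, ν (20 + i) = i

theorem sem_hasNbrFm {ν : ℕ → ℕ} {g : ℕ → Fin n} {v : Fin n} (hν : Assigns ν g v)
    (S : Finset (Fin 3)) :
    (hasNbrFm S).Sem n (inputState G L A B C zs).arr ν ↔ ∃ w ∈ A, G.Adj v w ∧ L w = S := by
  have hlist : ∀ w : Fin n, (listIsFm 61 S).Sem n (inputState G L A B C zs).arr
      (Function.update ν 61 w) ↔ L w = S := by
    intro w
    simp only [listIsFm, sem_allColors, Finset.ext_iff]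
    refine forall_congr' fun j => ?_
    have hj : (20 + (j : ℕ)) ≠ 61 := by omega
    by_cases hjS : j ∈ S <;> simp [hjS, Fm.Sem, hj, hν.color, input_list]
  simp only [hasNbrFm, Fm.sem_ex]
  refine exists_congr fun w => ?_
  simp only [Fm.Sem, hlist]
  simp [hν.cur, input_A, input_adj]

theorem sem_excludedFm {ν : ℕ → ℕ} {g : ℕ → Fin n} {v : Fin n} (hν : Assigns ν g v)
    (π : Pattern) (i : Fin 3) :
    (excludedFm π i).Sem n (inputState G L A B C zs).arr ν ↔
      Excluded G L A π (fun j => g (10 + j)) (g 13) (g 14) v i := by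
  have hg : ∀ j : Fin 3, ν (10 + j) = g (10 + j) :=
    fun j => hν.guess _ (by omega) (by omega)
  simp only [excludedFm, sem_orFm, sem_hasNbrFm hν, sem_anyColor, Fm.Sem, Excluded]
  simp [hν.cur, hg, hν.guess 13, hν.guess 14, input_adj]

theorem sem_reducedFm {ν : ℕ → ℕ} {g : ℕ → Fin n} {v : Fin n} (hν : Assigns ν g v)
    (π : Pattern) (i : Fin 3) :
    (reducedFm π i).Sem n (inputState G L A B C zs).arr ν ↔
      Reduced G L A C π (fun j => g (10 + j)) (g 13) (g 14) v i := by
  have h₁ : hasPartnerFm.Sem n (inputState G L A B C zs).arr ν ↔ ∃ w ∈ C, G.Adj v w := by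
    simp only [hasPartnerFm, Fm.sem_ex, Fm.Sem]
    simp [hν.cur, input_adj, input_C]
  have h₂ : partnerSeesFm.Sem n (inputState G L A B C zs).arr ν ↔
      ∃ w ∈ C, G.Adj v w ∧ G.Adj w (g 14) := by
    simp only [partnerSeesFm, Fm.sem_ex, Fm.Sem]
    simp [hν.cur, hν.guess 14, input_adj, input_C]
  simp only [reducedFm, sem_orFm, sem_allColors, sem_anyColor, Fm.Sem, h₁, h₂,
    sem_excludedFm hν, Reduced]
  simp [hν.cur, hν.color, input_C, input_list]

end Input

/-! ### Writing the collection -/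

section Output

variable {n : ℕ} {G : SimpleGraph (Fin n)} {L : Fin n → Finset (Fin 3)} {A B C : Finset (Fin n)}
  {zs : List (Finset (Fin n))}

/-- The member of the collection that belongs to the pattern `π` and the guessed vertices `g`. -/
noncomputable def member (G : SimpleGraph (Fin n)) (L : Fin n → Finset (Fin 3))
    (A C : Finset (Fin n)) (Z : Finset (Finset (Fin n))) (π : Pattern) (g : ℕ → Fin n) :
    Triple (Fin n) :=
  open Classical in
  ⟨Finset.univ, fun v => Finset.univ.filter fun i =>
    Reduced G L A C π (fun j => g (10 + j)) (g 13) (g 14) v i, Z⟩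

/-- The arrays `7` to `9` hold the triple `T` at the index `p`; its list of constraint sets
starts at the node `m`. -/
def HoldsMember (s : State) (m p : ℕ) (T : Triple (Fin n)) : Prop :=
  (∀ v : Fin n, s.arr 7 [p, v] = bit (v ∈ T.verts)) ∧
  (∀ (v : Fin n) (i : Fin 3), s.arr 8 [p, v, i] = bit (i ∈ T.pal v)) ∧
  s.arr 9 [p] = m

/-- The state `s` has the input `S₀` intact, and it holds the constants, the guesses `g` in the
variables from `10` to `ℓ - 1`, and the collection `P`.  All members share the list of constraint
sets of the input. -/
structure Ready (S₀ : State) (ℓ : ℕ) (g : ℕ → Fin n) (P : List (Triple (Fin n))) (s : State) :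
    Prop where
  size : s.var 0 = n
  first : s.var 1 = S₀.var 1
  count : s.var 2 = P.length
  color : ∀ i : Fin 3, s.var (20 + i) = i
  one : s.var 62 = 1
  guess : ∀ x, 10 ≤ x → x < ℓ → s.var x = g x
  input : ∀ a ≤ 6, s.arr a = S₀.arr a
  out : ∀ (p : ℕ) (hp : p < P.length), HoldsMember s (S₀.var 1) p P[p]

theorem Ready.of_agree {S₀ : State} {g : ℕ → Fin n} {P : List (Triple (Fin n))} {s s' : State}
    (h : Ready S₀ 15 g P s)
    (hv : ∀ x, x ≠ 15 → x ≠ 60 → x ≠ 61 → x ≠ 63 → s'.var x = s.var x)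
    (ha : ∀ a ≤ 6, s'.arr a = s.arr a)
    (hp : ∀ a, ∀ p < P.length, ∀ l, s'.arr a (p :: l) = s.arr a (p :: l)) :
    Ready S₀ 15 g P s' where
  size := by rw [hv 0 (by decide) (by decide) (by decide) (by decide), h.size]
  first := by rw [hv 1 (by decide) (by decide) (by decide) (by decide), h.first]
  count := by rw [hv 2 (by decide) (by decide) (by decide) (by decide), h.count]
  color i := by rw [hv _ (by omega) (by omega) (by omega) (by omega), h.color]
  one := by rw [hv 62 (by decide) (by decide) (by decide) (by decide), h.one]
  guess x h₁ h₂ := by rw [hv _ (by omega) (by omega) (by omega) (by omega), h.guess x h₁ h₂]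
  input a h₁ := by rw [ha a h₁, h.input a h₁]
  out p h₁ := by
    obtain ⟨h₂, h₃, h₄⟩ := h.out p h₁
    exact ⟨fun v => by rw [hp _ _ h₁, h₂ v], fun v i => by rw [hp _ _ h₁, h₃ v i],
      by rw [hp _ _ h₁, h₄]⟩

/-- Writing to the arrays `7` to `9` behind the last member. -/
theorem Ready.setArr {S₀ : State} {g : ℕ → Fin n} {P : List (Triple (Fin n))} {s : State}
    (h : Ready S₀ 15 g P s) {a : ℕ} (ha : 6 < a) (l : List ℕ) (k : ℕ) :
    Ready S₀ 15 g P (s.setArr a (P.length :: l) k) := by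
  refine h.of_agree (fun _ _ _ _ _ => rfl)
    (fun b hb => State.setArr_arr_of_ne _ _ _ (by omega)) fun b p hp l' => ?_
  by_cases hb : b = a
  · subst hb
    rw [State.setArr_arr_same, if_neg]
    intro h
    have := (List.cons.inj h).1
    omega
  · rw [State.setArr_arr_of_ne _ _ _ hb]

/-- Started with the guesses `g 10, …, g (ℓ - 1)`, the program `prog` appends `f g` to the
collection in at most `T` steps. -/
def Emits (S₀ : State) (ℓ : ℕ) (prog : Cmd) (T : ℕ) (f : (ℕ → Fin n) → List (Triple (Fin n))) :
    Prop :=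
  ∀ g P s, Ready S₀ ℓ g P s → Runs prog s T (Ready S₀ ℓ g (P ++ f g))

/-- The lists for all values of the guess number `ℓ`, one after the other. -/
def forGuess (ℓ : ℕ) (f : (ℕ → Fin n) → List (Triple (Fin n))) (g : ℕ → Fin n) :
    List (Triple (Fin n)) :=
  (List.finRange n).flatMap fun k => f (Function.update g ℓ k)

theorem Emits.forVar {S₀ : State} {ℓ : ℕ} {prog : Cmd} {T : ℕ}
    {f : (ℕ → Fin n) → List (Triple (Fin n))} (h₁ : 10 ≤ ℓ) (h₂ : ℓ < 15)
    (h : Emits S₀ (ℓ + 1) prog T f) :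
    Emits S₀ ℓ (forVar ℓ prog) (n * (T + 2) + 2) (forGuess ℓ f) := by
  intro g P s hs
  have hset : ∀ (P' : List (Triple (Fin n))) (s' : State) (k : ℕ), Ready S₀ ℓ g P' s' →
      Ready S₀ ℓ g P' (s'.setVar ℓ k) := by
    intro P' s' k h'
    have hv : ∀ x, x ≠ ℓ → (s'.setVar ℓ k).var x = s'.var x :=
      fun x hx => s'.setVar_var_of_ne _ hx
    exact ⟨by rw [hv _ (by omega), h'.size], by rw [hv _ (by omega), h'.first],
      by rw [hv _ (by omega), h'.count], fun i => by rw [hv _ (by omega), h'.color],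
      by rw [hv _ (by omega), h'.one], fun x hx hx' => by rw [hv _ (by omega), h'.guess x hx hx'],
      h'.input, h'.out⟩
  let I : ℕ → State → Prop := fun k s' => s'.var ℓ = k ∧
    Ready S₀ ℓ g (P ++ ((List.finRange n).take k).flatMap fun k => f (Function.update g ℓ k)) s'
  refine Runs.mono (runs_forVar I (n := n) (T := T) (fun k s' h' => ⟨h'.1, h'.2.size⟩)
    ⟨by simp, hset _ _ _ (by simpa using hs)⟩ ?_) le_rfl ?_
  · rintro k hk s' ⟨h₃, h₄⟩
    have h₅ : Ready S₀ (ℓ + 1) (Function.update g ℓ ⟨k, hk⟩) _ s' :=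
      { h₄ with
        guess := fun x hx hx' => by
          rcases Nat.lt_succ_iff_lt_or_eq.1 hx' with hx'' | rfl
          · rw [Function.update_of_ne (by omega), h₄.guess x hx hx'']
          · rw [Function.update_self, h₃] }
    refine Runs.mono (h _ _ s' h₅) le_rfl fun s'' h₆ => ?_
    have hk' : s''.var ℓ = k := by
      rw [h₆.guess ℓ h₁ (by omega), Function.update_self]
    refine ⟨by rw [State.setVar_var_self, hk'], hset _ _ _ ?_⟩
    rw [List.take_succ_eq_append_getElem (by simpa using hk), List.flatMap_append,
      ← List.append_assoc]
    simp only [List.flatMap_cons, List.flatMap_nil, List.append_nil, List.getElem_finRange,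
      Fin.cast_mk]
    exact { h₆ with
      guess := fun x hx hx' => by
        rw [h₆.guess x hx (by omega), Function.update_of_ne (by omega)] }
  · rintro s' ⟨-, h'⟩
    rwa [List.take_of_length_le (by simp)] at h'

/-- The program writing whether the colour `i` is in the list of the current vertex. -/
def cellProg (π : Pattern) (i : Fin 3) : Cmd :=
  .seq (reducedFm π i).comp (.store 8 [2, 15, 20 + i] 60)

theorem runs_cellProg {g : ℕ → Fin n} {P : List (Triple (Fin n))} {s : State} {v : Fin n}
    (Z : Finset (Finset (Fin n))) (hs : Ready (inputState G L A B C zs) 15 g P s)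
    (hv : s.var 15 = v) (π : Pattern) (i : Fin 3) :
    Runs (cellProg π i) s ((reducedFm π i).cost * n + 1) fun s' =>
      Ready (inputState G L A B C zs) 15 g P s' ∧ s'.var 15 = v ∧ s'.arr 7 = s.arr 7 ∧
      ∀ idx, s'.arr 8 idx = if idx = [P.length, (v : ℕ), (i : ℕ)] then
        bit (i ∈ (member G L A C Z π g).pal v) else s.arr 8 idx := by
  have hn : 1 ≤ n := v.pos
  have hrun := (reducedFm π i).runs hn false (scoped_reducedFm π i) s hs.size hs.one
    fun a ha => hs.input a (by omega)
  simp only [Bool.false_eq_true, if_false] at hrun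
  refine Runs.seq hrun ?_
  rintro s₁ ⟨h₁, h₂, h₃⟩
  have hvar : ∀ x, x < 60 → s₁.var x = s.var x :=
    fun x hx => h₃ x (by omega) fun _ => by omega
  rw [sem_reducedFm ⟨hv, hs.guess, hs.color⟩] at h₁
  have hidx : [2, 15, 20 + (i : ℕ)].map s₁.var = [P.length, (v : ℕ), (i : ℕ)] := by
    simp [hvar 2, hvar 15, hvar (20 + i) (by omega), hs.count, hs.color, hv]
  have hs₁ : Ready (inputState G L A B C zs) 15 g P s₁ :=
    hs.of_agree (fun x _ h₄ h₅ h₆ => h₃ x h₄ fun _ => ⟨h₅, h₆⟩) (fun a _ => by rw [h₂])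
      fun a p _ l => by rw [h₂]
  refine Runs.store ?_
  rw [hidx]
  refine ⟨hs₁.setArr (by decide) _ _, ?_, ?_, ?_⟩
  · rw [State.setArr_var, hvar 15 (by decide), hv]
  · rw [State.setArr_arr_of_ne _ _ _ (by decide), h₂]
  · intro idx
    rw [State.setArr_arr_same, h₁, h₂]
    simp [member]

/-- The program writing the lists of all vertices of a new member. -/
def rowProg (π : Pattern) : Cmd :=
  forVar 15 (.seq (.store 7 [2, 15] 62)
    (.seq (cellProg π 0) (.seq (cellProg π 1) (cellProg π 2))))

/-- The linear factor of the time spent on one vertex by `rowProg`. -/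
def rowCost (π : Pattern) : ℕ :=
  (reducedFm π 0).cost + (reducedFm π 1).cost + (reducedFm π 2).cost

theorem runs_rowProg {g : ℕ → Fin n} {P : List (Triple (Fin n))} {s : State}
    (Z : Finset (Finset (Fin n))) (hs : Ready (inputState G L A B C zs) 15 g P s) (π : Pattern) :
    Runs (rowProg π) s (n * ((rowCost π * n + 4) + 2) + 2) fun s' =>
      Ready (inputState G L A B C zs) 15 g P s' ∧ ∀ v : Fin n, s'.arr 7 [P.length, v] = 1 ∧
        ∀ i : Fin 3, s'.arr 8 [P.length, v, i] = bit (i ∈ (member G L A C Z π g).pal v) := by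
  let I : ℕ → State → Prop := fun k s' => s'.var 15 = k ∧
    Ready (inputState G L A B C zs) 15 g P s' ∧
    ∀ v : Fin n, (v : ℕ) < k → s'.arr 7 [P.length, v] = 1 ∧
      ∀ i : Fin 3, s'.arr 8 [P.length, v, i] = bit (i ∈ (member G L A C Z π g).pal v)
  have hset : ∀ (s' : State) (k : ℕ), Ready (inputState G L A B C zs) 15 g P s' →
      Ready (inputState G L A B C zs) 15 g P (s'.setVar 15 k) :=
    fun s' k h => h.of_agree (fun x hx _ _ _ => s'.setVar_var_of_ne _ hx) (fun _ _ => rfl)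
      fun _ _ _ _ => rfl
  refine Runs.mono (runs_forVar I (n := n) (T := rowCost π * n + 4)
    (fun k s' h => ⟨h.1, h.2.1.size⟩) ⟨by simp, hset _ _ hs, fun v hv => by omega⟩ ?_) le_rfl
    fun s' h => ⟨h.2.1, fun v => h.2.2 v v.2⟩
  rintro k hk s₁ ⟨h₁, h₂, h₃⟩
  refine Runs.mono (Runs.seq (T₁ := 1) (R := fun s₂ => s₂ = s₁.setArr 7 [P.length, k] 1)
    (T₂ := ((reducedFm π 0).cost * n + 1) + (((reducedFm π 1).cost * n + 1) +
      ((reducedFm π 2).cost * n + 1))) (Runs.store ?_) ?_) ?_ fun _ h => h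
  · simp [h₂.count, h₁, h₂.one]
  swap
  · simp only [rowCost, add_mul]
    omega
  rintro s₂ rfl
  refine Runs.seq (runs_cellProg (v := ⟨k, hk⟩) Z (h₂.setArr (by decide) _ _) h₁ π 0) ?_
  rintro s₃ ⟨r₃, v₃, a₃, b₃⟩
  refine Runs.seq (runs_cellProg (v := ⟨k, hk⟩) Z r₃ v₃ π 1) ?_
  rintro s₄ ⟨r₄, v₄, a₄, b₄⟩
  refine Runs.mono (runs_cellProg (v := ⟨k, hk⟩) Z r₄ v₄ π 2) le_rfl ?_
  rintro s₅ ⟨r₅, v₅, a₅, b₅⟩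
  refine ⟨by rw [State.setVar_var_self, v₅], hset _ _ r₅, fun v hv => ?_⟩
  rw [State.setVar_arr, a₅, a₄, a₃, State.setArr_arr_same]
  rcases Nat.lt_succ_iff_lt_or_eq.1 hv with hv | hv
  · have hne : (v : ℕ) ≠ k := hv.ne
    refine ⟨by simpa [hne] using (h₃ v hv).1, fun i => ?_⟩
    rw [b₅, b₄, b₃, State.setArr_arr_of_ne _ _ _ (by decide)]
    simpa [hne] using (h₃ v hv).2 i
  · obtain rfl : v = ⟨k, hk⟩ := Fin.ext hv
    refine ⟨by simp, fun i => ?_⟩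
    rw [b₅, b₄, b₃]
    fin_cases i <;> simp

/-- The program appending one member to the collection. -/
def memberProg (π : Pattern) : Cmd :=
  .seq (rowProg π) (.seq (.store 9 [2] 1) (.succ 2 2))

theorem emits_memberProg (Z : Finset (Finset (Fin n))) (hn : 1 ≤ n) (π : Pattern) :
    Emits (inputState G L A B C zs) 15 (memberProg π) ((rowCost π + 10) * n ^ 2)
      fun g => [member G L A C Z π g] := by
  intro g P s hs
  refine Runs.mono (Runs.seq (runs_rowProg Z hs π) (T₂ := 1 + 1) ?_) (by nlinarith) fun _ h => h
  rintro s₁ ⟨h₁, h₂⟩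
  have hidx : [2].map s₁.var = [P.length] := by simp [h₁.count]
  refine Runs.seq (R := fun s₂ => s₂ =
    s₁.setArr 9 [P.length] ((inputState G L A B C zs).var 1)) (Runs.store ?_) ?_
  · rw [hidx, h₁.first]
  intro s₂ hs₂
  have h₃ : Ready (inputState G L A B C zs) 15 g P s₂ := hs₂ ▸ h₁.setArr (by decide) _ _
  have hv : ∀ x, x ≠ 2 → (s₂.setVar 2 (s₂.var 2 + 1)).var x = s₂.var x :=
    fun x hx => s₂.setVar_var_of_ne _ hx
  refine Runs.succ ⟨by rw [hv _ (by decide), h₃.size], by rw [hv _ (by decide), h₃.first], ?_,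
    fun i => by rw [hv _ (by omega), h₃.color], by rw [hv _ (by decide), h₃.one],
    fun x hx hx' => by rw [hv _ (by omega), h₃.guess x hx hx'], h₃.input, ?_⟩
  · rw [State.setVar_var_self, h₃.count]
    simp
  · intro p hp
    by_cases hp' : p < P.length
    · rw [List.getElem_append_left hp']
      exact h₃.out p hp'
    · obtain rfl : p = P.length := by
        simp at hp
        omega
      rw [List.getElem_concat_length rfl]
      refine ⟨fun v => ?_, fun v i => ?_, ?_⟩
      · simpa [hs₂, State.setArr, member, bit] using (h₂ v).1
      · simpa [hs₂, State.setArr] using (h₂ v).2 i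
      · simp [hs₂, State.setArr]

/-- Loops over all guesses in the variables `10` to `14`. -/
def patternProg (π : Pattern) : Cmd :=
  forVar 10 (forVar 11 (forVar 12 (forVar 13 (forVar 14 (memberProg π)))))

/-- The members for the pattern `π`. -/
noncomputable def patternList (G : SimpleGraph (Fin n)) (L : Fin n → Finset (Fin 3))
    (A C : Finset (Fin n)) (Z : Finset (Finset (Fin n))) (π : Pattern) :
    (ℕ → Fin n) → List (Triple (Fin n)) :=
  forGuess 10 <| forGuess 11 <| forGuess 12 <| forGuess 13 <| forGuess 14 fun g =>
    [member G L A C Z π g]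

theorem Emits.mono {S₀ : State} {ℓ : ℕ} {prog : Cmd} {T T' : ℕ}
    {f : (ℕ → Fin n) → List (Triple (Fin n))} (h : Emits S₀ ℓ prog T f) (hT : T ≤ T') :
    Emits S₀ ℓ prog T' f :=
  fun g P s hs => Runs.mono (h g P s hs) hT fun _ h => h

theorem emits_patternProg (Z : Finset (Finset (Fin n))) (hn : 1 ≤ n) (π : Pattern) :
    Emits (inputState G L A B C zs) 10 (patternProg π) ((rowCost π + 30) * n ^ 7)
      (patternList G L A C Z π) := by
  have hT : ∀ K e : ℕ, n * (K * n ^ e + 2) + 2 ≤ (K + 4) * n ^ (e + 1) := by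
    intro K e
    have h₁ : n ≤ n ^ (e + 1) := Nat.le_self_pow (by omega) n
    have h₂ : n * (K * n ^ e + 2) + 2 = K * n ^ (e + 1) + 2 * n + 2 := by ring
    rw [h₂, add_mul]
    omega
  have h₀ := emits_memberProg (G := G) (L := L) (A := A) (B := B) (C := C) (zs := zs) Z hn π
  have h₁ := (h₀.forVar (ℓ := 14) (by decide) (by decide)).mono (hT _ _)
  have h₂ := (h₁.forVar (ℓ := 13) (by decide) (by decide)).mono (hT _ _)
  have h₃ := (h₂.forVar (ℓ := 12) (by decide) (by decide)).mono (hT _ _)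
  have h₄ := (h₃.forVar (ℓ := 11) (by decide) (by decide)).mono (hT _ _)
  exact (h₄.forVar (ℓ := 10) (by decide) (by decide)).mono (hT _ _)

theorem length_forGuess {ℓ : ℕ} {f : (ℕ → Fin n) → List (Triple (Fin n))} {m : ℕ}
    (hf : ∀ g, (f g).length = m) (g : ℕ → Fin n) : (forGuess ℓ f g).length = n * m := by
  simp [forGuess, List.length_flatMap, hf]

theorem length_patternList (Z : Finset (Finset (Fin n))) (π : Pattern) (g : ℕ → Fin n) :
    (patternList G L A C Z π g).length = n ^ 5 := by
  rw [patternList, length_forGuess (length_forGuess (length_forGuess (length_forGuess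
    (length_forGuess (m := 1) fun g => rfl))))]
  ring

theorem exists_of_mem_patternList {Z : Finset (Finset (Fin n))} {π : Pattern} {g : ℕ → Fin n}
    {T : Triple (Fin n)} (h : T ∈ patternList G L A C Z π g) :
    ∃ g', T = member G L A C Z π g' := by
  simp only [patternList, forGuess, List.mem_flatMap, List.mem_singleton] at h
  obtain ⟨k₀, -, k₁, -, k₂, -, k₃, -, k₄, -, h⟩ := h
  exact ⟨_, h⟩

theorem member_congr {Z : Finset (Finset (Fin n))} {π : Pattern} {g g' : ℕ → Fin n}
    (h : ∀ j : Fin 3, g (10 + j) = g' (10 + j)) (h₁ : g 13 = g' 13) (h₂ : g 14 = g' 14) :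
    member G L A C Z π g = member G L A C Z π g' := by
  rw [member, member, show (fun j : Fin 3 => g (10 + j)) = fun j : Fin 3 => g' (10 + j) from
    funext h, h₁, h₂]

theorem member_mem_patternList (Z : Finset (Finset (Fin n))) (π : Pattern) (g g' : ℕ → Fin n) :
    member G L A C Z π g' ∈ patternList G L A C Z π g := by
  simp only [patternList, forGuess, List.mem_flatMap, List.mem_singleton, List.mem_finRange,
    true_and]
  refine ⟨g' 10, g' 11, g' 12, g' 13, g' 14, ?_⟩
  refine member_congr (fun j => ?_) (by simp) (by simp)
  fin_cases j <;> simp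

/-- The program building the collection. -/
noncomputable def buildProg : Cmd :=
  .seq (.seq (.const 62 1) (.seq (.const 21 1) (.const 22 2)))
    (((Finset.univ : Finset Pattern).toList.map patternProg).foldr .seq .skip)

theorem emits_foldr (Z : Finset (Finset (Fin n))) (hn : 1 ≤ n) (l : List Pattern) :
    Emits (inputState G L A B C zs) 10 ((l.map patternProg).foldr .seq .skip)
      ((l.map fun π => rowCost π + 30).sum * n ^ 7)
      fun g => l.flatMap fun π => patternList G L A C Z π g := by
  induction l with
  | nil => exact fun g P s hs => Runs.skip (by simpa using hs)
  | cons π l ih =>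
    intro g P s hs
    refine Runs.mono (Runs.seq (emits_patternProg Z hn π g P s hs) fun s' hs' => ih g _ s' hs') ?_
      fun s' hs' => ?_
    · simp [add_mul]
    · simpa using hs'

/-- The input list runs from the last set of `zs` to the first. -/
theorem isLinkedList_reverse {s : State} {G : SimpleGraph (Fin n)} {L : Fin n → Finset (Fin 3)}
    (h5 : s.arr 5 = (inputState G L A B C zs).arr 5)
    (h6 : s.arr 6 = (inputState G L A B C zs).arr 6) :
    ∀ m ≤ zs.length, IsLinkedList s m (zs.take m).reverse := by
  intro m
  induction m with
  | zero => intro _; simp [IsLinkedList]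
  | succ m ih =>
    intro hm
    rw [List.take_succ_eq_append_getElem hm, List.reverse_append]
    refine ⟨Nat.succ_ne_zero m, fun v => ?_, ?_⟩
    · rw [h5]
      have hm' : m < zs.length := hm
      simp [inputState, MemWord, hm']
    · rw [h6]
      simpa [inputState, hm] using ih (by omega)

end Output

/-- The collection of all members, for all patterns and all guesses. -/
noncomputable def collection {n : ℕ} (hn : 1 ≤ n) (G : SimpleGraph (Fin n))
    (L : Fin n → Finset (Fin 3)) (A C : Finset (Fin n)) (Z : Finset (Finset (Fin n))) :
    List (Triple (Fin n)) :=
  (Finset.univ : Finset Pattern).toList.flatMap fun π =>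
    patternList G L A C Z π fun _ => ⟨0, hn⟩

theorem mem_collection {n : ℕ} (hn : 1 ≤ n) {G : SimpleGraph (Fin n)}
    {L : Fin n → Finset (Fin 3)} {A C : Finset (Fin n)} {Z : Finset (Finset (Fin n))}
    {T : Triple (Fin n)} :
    T ∈ collection hn G L A C Z ↔ ∃ π g, T = member G L A C Z π g := by
  simp only [collection, List.mem_flatMap, Finset.mem_toList, Finset.mem_univ, true_and]
  constructor
  · rintro ⟨π, h⟩
    exact ⟨π, exists_of_mem_patternList h⟩
  · rintro ⟨π, g, rfl⟩
    exact ⟨π, member_mem_patternList Z π _ g⟩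

theorem runs_buildProg {n : ℕ} (hn : 1 ≤ n) (G : SimpleGraph (Fin n))
    (L : Fin n → Finset (Fin 3)) (A B C : Finset (Fin n)) (zs : List (Finset (Fin n))) :
    Runs buildProg (inputState G L A B C zs)
      (3 + ((Finset.univ : Finset Pattern).toList.map fun π => rowCost π + 30).sum * n ^ 7)
      fun s => IsOutput s (collection hn G L A C zs.toFinset) := by
  have hinit : Runs (.seq (.const 62 1) (.seq (.const 21 1) (.const 22 2)))
      (inputState G L A B C zs) (1 + (1 + 1))
      (Ready (inputState G L A B C zs) 10 (fun _ => ⟨0, hn⟩) []) := by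
    refine Runs.seq (Runs.const rfl) ?_
    rintro s₁ rfl
    refine Runs.seq (Runs.const rfl) ?_
    rintro s₂ rfl
    refine Runs.const ⟨rfl, rfl, rfl, fun i => ?_, rfl, fun x hx hx' => by omega,
      fun _ _ => rfl, fun p hp => by simp at hp⟩
    fin_cases i <;> rfl
  refine Runs.mono (Runs.seq hinit fun s₁ hs₁ =>
    emits_foldr zs.toFinset hn _ _ _ s₁ hs₁) le_rfl ?_
  intro s hs
  rw [List.nil_append] at hs
  refine ⟨hs.count, fun p hp => ?_⟩
  obtain ⟨h₁, h₂, h₃⟩ := hs.out p hp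
  obtain ⟨π, g, hT⟩ := (mem_collection hn).1 (List.getElem_mem hp)
  refine ⟨h₁, fun v _ i => h₂ v i, zs.reverse, ?_, ?_⟩
  · rw [List.toFinset_reverse]
    rw [hT]
    rfl
  · rw [h₃]
    have := isLinkedList_reverse (hs.input 5 (by decide)) (hs.input 6 (by decide)) zs.length le_rfl
    rwa [List.take_length] at this

end ListColoring

/-! ### The restriction and its computation -/

theorem mainTheorem3 :
    ∃ (build ext : RAM.Cmd) (K : ℕ),
    ∀ (n : ℕ) (G : SimpleGraph (Fin n)) (L : Fin n → Finset (Fin 3))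
      (A B C : Finset (Fin n)) (Z : Finset (Finset (Fin n))),
      ¬ (SimpleGraph.pathGraph 7).IsIndContained G →
      ¬ (SimpleGraph.cycleGraph 3).IsIndContained G →
      (∀ v, (L v).Nonempty) →
      A ∪ B ∪ C = Finset.univ → Disjoint A B → Disjoint A C → Disjoint B C →
      ListColoring.AnticompleteTo G (B : Set (Fin n)) (C : Set (Fin n)) →
      (∀ D : (G.induce (C : Set (Fin n))).ConnectedComponent, D.supp.ncard ≤ 2) →
      (∀ c ∈ C, ∃ a ∈ A, G.Adj c a) →
      (∀ a ∈ A, ∃ c ∈ C, G.Adj a c) →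
      (∀ a ∈ A, (L a).card ≤ 2) →
      (∀ c ∈ C, (L c).card = 3) →
      (∀ u, ¬ ListColoring.IsDominated G u) →
      (∀ c₁ ∈ C, ∀ c₂ ∈ C, ∀ i j k : Fin 3, i ≠ j → i ≠ k → j ≠ k →
        ListColoring.CompleteTo G
          (ListColoring.nbrs G L A i j c₁ ∩ ListColoring.nonNbrs G L A i j c₂)
          (ListColoring.nonNbrs G L A i k c₁ ∩ ListColoring.nbrs G L A i k c₂)) →
      (∀ i j : Fin 3, i ≠ j → ∃ b ∈ B,
        ListColoring.CompleteTo G {b} (ListColoring.listClass L A {i, j})) →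
      (∀ S ∈ Z, S ⊆ A) →
      ∃ P : List (ListColoring.Triple (Fin n)),
        P.length ≤ K * n ^ 7 ∧
        (∀ T ∈ P, T.IsSub (ListColoring.Triple.full L Z)) ∧
        (ListColoring.CollColorable G P → (ListColoring.Triple.full L Z).Colorable G) ∧
        (∀ T ∈ P, A ∪ B ⊆ T.verts) ∧
        (∀ T ∈ P, (∀ v ∈ A ∪ B, T.pal v = L v) ∧
          (∀ v ∈ T.verts ∩ C, (T.pal v).card ≤ 2) ∧
          T.cons.card ≤ K * (Z.card + n)) ∧
        ((ListColoring.Triple.full L Z).Colorable G → ListColoring.CollColorable G P) ∧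
        ∀ zs : List (Finset (Fin n)), zs.toFinset = Z →
          ∃ (s : RAM.State) (t : ℕ),
            RAM.Exec build (ListColoring.inputState G L A B C zs) s t ∧
            t ≤ K * n ^ 7 ∧
            ListColoring.IsOutput s P ∧
            ListColoring.ExtendsWithin ext s G P (ListColoring.Triple.full L Z) (K * n) := by
  classical
  refine ⟨ListColoring.buildProg, .skip,
    3 + ((Finset.univ : Finset ListColoring.Pattern).toList.map
      fun π => ListColoring.rowCost π + 30).sum +
      (Finset.univ : Finset ListColoring.Pattern).card, ?_⟩
  intro n G L A B C Z h7 h3 hL hV hAB hAC hBC hBCa hC hCA _ hLA hLC _ hcomp hB hZ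
  -- The set `B` is not empty, so there is at least one vertex; for `n = 0` no step is allowed.
  obtain ⟨b, -, -⟩ := hB 0 1 (by decide)
  have hn : 1 ≤ n := b.pos
  have hLC' : ∀ c ∈ C, ∀ i, i ∈ L c := fun c hc i => by
    rw [Finset.eq_univ_of_card (L c) (by simpa using hLC c hc)]
    exact Finset.mem_univ i
  have hmem : ∀ T, T ∈ ListColoring.collection hn G L A C Z ↔
      ∃ π g, T = ListColoring.member G L A C Z π g := fun T => ListColoring.mem_collection hn
  have hpal : ∀ π g v i, i ∈ (ListColoring.member G L A C Z π g).pal v ↔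
      ListColoring.Reduced G L A C π (fun j => g (10 + j)) (g 13) (g 14) v i := by
    intro π g v i
    simp [ListColoring.member]
  have hsub : ∀ π g v, (ListColoring.member G L A C Z π g).pal v ⊆ L v := by
    intro π g v i hi
    by_cases hv : v ∈ C
    · exact hLC' v hv i
    · exact (ListColoring.reduced_iff_of_notMem hv i).1 ((hpal _ _ _ _).1 hi)
  -- A colouring of a member is a colouring of the whole triple, so extending it takes no time.
  have hcol : ∀ T ∈ ListColoring.collection hn G L A C Z, ∀ c, T.IsColoring G c →
      (ListColoring.Triple.full L Z).IsColoring G c := by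
    intro T hT c hc
    obtain ⟨π, g, rfl⟩ := (hmem T).1 hT
    exact ⟨hc.1, fun v hv => hsub π g v (hc.2.1 v hv), hc.2.2⟩
  refine ⟨ListColoring.collection hn G L A C Z, ?_, ?_, ?_, ?_, ?_, ?_, ?_⟩
  · have h₁ : (ListColoring.collection hn G L A C Z).length =
        (Finset.univ : Finset ListColoring.Pattern).card * n ^ 5 := by
      simp only [ListColoring.collection, List.length_flatMap, ListColoring.length_patternList,
        List.map_const', List.sum_replicate, Finset.length_toList, smul_eq_mul]
    rw [h₁]
    exact Nat.mul_le_mul (by omega) (Nat.pow_le_pow_right hn (by decide))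
  · intro T hT
    obtain ⟨π, g, rfl⟩ := (hmem T).1 hT
    refine ⟨Finset.subset_univ _, fun v _ => ⟨?_, hsub π g v⟩, fun S _ => Finset.subset_univ _⟩
    exact (ListColoring.Reduced.nonempty (hL v)).imp fun i hi => (hpal _ _ _ _).2 hi
  · rintro ⟨T, hT, c, hc⟩
    exact ⟨c, hcol T hT c hc⟩
  · intro T hT
    obtain ⟨π, g, rfl⟩ := (hmem T).1 hT
    exact Finset.subset_univ _
  · intro T hT
    obtain ⟨π, g, rfl⟩ := (hmem T).1 hT
    refine ⟨fun v hv => ?_, fun v hv => ?_, ?_⟩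
    · have hvC : v ∉ C := fun hvC => by
        rcases Finset.mem_union.1 hv with h | h
        · exact Finset.disjoint_left.1 hAC h hvC
        · exact Finset.disjoint_left.1 hBC h hvC
      ext i
      rw [hpal, ListColoring.reduced_iff_of_notMem hvC]
    · obtain ⟨i, hi⟩ := ListColoring.Reduced.exists_not (G := G) (L := L) (A := A) (π := π)
        (a := fun j => g (10 + j)) (p := g 13) (q := g 14) (Finset.mem_inter.1 hv).2
      have : (ListColoring.member G L A C Z π g).pal v ≠ Finset.univ := fun h =>
        hi ((hpal _ _ _ _).1 (h ▸ Finset.mem_univ i))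
      have h₂ := (Finset.card_lt_iff_ne_univ _).2 this
      simp only [Fintype.card_fin] at h₂
      omega
    · exact (Nat.le_add_right _ _).trans (Nat.le_mul_of_pos_left _ (by omega))
  · rintro ⟨φ, hφ₁, hφ₂, hφ₃⟩
    obtain ⟨π, a, p, q, φ', h₁, h₂, h₃⟩ := ListColoring.exists_reduced_coloring G L A B C h7 h3
      (fun v => by simpa [or_assoc] using (Finset.ext_iff.1 hV v).2 (Finset.mem_univ v)) hAC hBCa hC
      hCA hLA hcomp hB φ (fun u v => hφ₁ u (Finset.mem_univ u) v (Finset.mem_univ v))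
      (fun v => hφ₂ v (Finset.mem_univ v))
    let g : ℕ → Fin n := fun x => if h : x - 10 < 3 then a ⟨x - 10, h⟩ else if x = 13 then p else q
    have hg : (fun j : Fin 3 => g (10 + j)) = a := by
      funext j
      simp [g]
    refine ⟨ListColoring.member G L A C Z π g, (hmem _).2 ⟨π, g, rfl⟩, φ',
      fun u _ v _ => h₁ u v, fun v _ => (hpal _ _ _ _).2 ?_, fun S hS u hu v hv => ?_⟩
    · rw [hg]
      exact h₂ v
    · rw [h₃ u (hZ S hS hu), h₃ v (hZ S hS hv)]
      exact hφ₃ S hS u hu v hv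
  · rintro zs rfl
    obtain ⟨s, t, h₁, h₂, h₃⟩ := ListColoring.runs_buildProg hn G L A B C zs
    refine ⟨s, t, h₁, h₂.trans ?_, h₃, ?_⟩
    · have := Nat.one_le_pow 7 n hn
      nlinarith
    · intro p hp c hc
      have hT := List.getElem_mem hp
      refine ⟨_, 0, c, .skip _, Nat.zero_le _, fun v => ?_, hcol _ hT c hc, fun _ _ => rfl⟩
      obtain ⟨π, g, hT'⟩ := (hmem _).1 hT
      have hv : v ∈ (ListColoring.collection hn G L A C zs.toFinset)[p].verts := by
        rw [hT']
        exact Finset.mem_univ v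
      simp [ListColoring.withColoring, hv]
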